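/- **Setting.** Let $n\ge1$, $N\ge1$, $T>0$. Consider $\dot{\mathbf x}=\mathbf f(\mathbf x)+\mathbf g(\mathbf x)u+\mathbf w(t)$ on $\mathbb R^n$ with $\mathbf f(\mathbf x)=(x_2,\dots,x_n,f(\mathbf x))$, $\mathbf g(\mathbf x)=(0,\dots,0,g(\mathbf x))$, where $f,g:\mathbb R^n\to\mathbb R$ are $C^1$, $f(\mathbf 0)=0$ and $g$ vanishes nowhere. The state constraint set $\mathcal X=\{\mathbf x: \mathbf L_j^\top\mathbf x\le\ell_j,\ j=1,\dots,q\}$ is compact with $\mathbf 0\in\operatorname{Int}\mathcal X$; the input constraint set is $[-u_{\max},u_{\max}]$, $u_{\max}>0$. Let $\mathbf K\in\mathbb R^n$ be such that the matrix $\mathbf F$ given by $\mathbf F\mathbf e=(e_2,\dots,e_n,-\mathbf K^\top\mathbf e)$ is Hurwitz, let $\mathbf Q,\mathbf P\succ0$ satisfy $\mathbf F^\top\mathbf P+\mathbf P\mathbf F=-\mathbf Q$, let $\overline w\ge0$ and put $\gamma=4\lambda_{\max}(\mathbf P)^3/\lambda_{\min}(\mathbf Q)^2$, $\overline e=\sqrt{\gamma\overline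 w^2/\lambda_{\min}(\mathbf P)}$, $\mathcal E=\{\mathbf v:\mathbf v^\top\mathbf P\mathbf v\le\gamma\overline w^2\}$, $\mathcal X\ominus\mathcal E=\{\mathbf x:\mathbf x+\mathcal E\subseteq\mathcal X\}$. *Low-level controller.* For a reference $\mathbf x_d$, with $\mathbf e=\mathbf x-\mathbf x_d(t)$, let $k^{\rm clf}_{\mathbf x_d}(\mathbf x,t)$ be the minimizer of $\frac12|u-k^{\rm ff}|^2$, $k^{\rm ff}=-g(\mathbf x)^{-1}(f(\mathbf x)-\dot x^n_d(t))$, over all $u\in\mathbb R$ with $2\mathbf e^\top\mathbf P\big[(e_2,\dots,e_n,f(\mathbf x)-\dot x_d^n(t))+\mathbf g(\mathbf x)u\big]\le-\lambda_{\min}(\mathbf Q)\|\mathbf e\|_2^2$. *References.* For points $\mathbf x_0,\dots,\mathbf x_N$ let $r_k$ be the unique polynomial of degree at most $2n-1$ on $[0,T]$ (a Bézier curve) such that $\mathbf r_k=(r_k,\dot r_k,\dots,r_k^{(n-1)})$ satisfies $\mathbf r_k(0)=\mathbf x_k$, $\mathbf r_k(T)=\mathbf x_{k+1}$. The reference started at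 $\underline t$ is $\mathbf x_d(t)=\mathbf r_k(t-\underline t-kT)$ for $t\in[\underline t+kT,\underline t+(k+1)T)$, $\mathbf x_d(\underline t+NT)=\mathbf x_N$. Let $(\xi_k)_{j,i}$, $i=0,\dots,2n-1$, be the Bernstein coefficients (control points) of order $2n-1$ of $r_k^{(j)}$ on $[0,T]$, and $(\boldsymbol\zeta_k)_i=((\xi_k)_{0,i},\dots,(\xi_k)_{n-1,i})$. *FTOCP.* For $\alpha,\beta\ge0$ let $\mathbf M_{\alpha,\beta}$ be the projection of $\begin{bmatrix}2\alpha\beta&\beta\\\beta&0\end{bmatrix}$ onto the positive semidefinite matrices, and $$\mathbf N_{\alpha,\beta}(\overline{\mathbf x})=\begin{bmatrix}2\alpha\beta\overline e+\alpha|g(\overline{\mathbf x})^{-1}|+\beta\|\mathbf K\|_2\overline e\\|g(\overline{\mathbf x})^{-1}|+\beta\overline e\end{bmatrix},\qquad \Gamma_{\alpha,\beta}(\overline{\mathbf x})=\overline e\,(\beta\overline e+|g(\overline{\mathbf x})^{-1}|)(\alpha+\|\mathbf K\|_2).$$ For a linearization point $(\overline{\mathbf x},\overline u)$ put $\mathbf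 A_c=\frac{\partial\mathbf f}{\partial\mathbf x}(\overline{\mathbf x})+\frac{\partial\mathbf g}{\partial\mathbf x}(\overline{\mathbf x})\overline u$, $\mathbf B_c=\mathbf g(\overline{\mathbf x})$, $\mathbf C_c=\mathbf f(\overline{\mathbf x})+\mathbf g(\overline{\mathbf x})\overline u-\mathbf A_c\overline{\mathbf x}-\mathbf B_c\overline u$ and $\mathbf A=e^{\mathbf A_cT}$, $\mathbf B=\int_0^Te^{\mathbf A_c(T-\tau)}\mathbf B_c\,d\tau$, $\mathbf C=\int_0^Te^{\mathbf A_c(T-\tau)}\mathbf C_c\,d\tau$. Given linearization points $(\overline{\mathbf x}_k,\overline u_k)_{k=0}^{N-1}$, with matrices $\mathbf A_k,\mathbf B_k,\mathbf C_k$, and a current state $\mathbf x$, the FTOCP is to minimize $\sum_{k=0}^{N-1}h(\mathbf x_k,u_k)+J(\mathbf x_N)$ (with convex $h:\mathcal X\times\mathbb R\to\mathbb R_{\ge0}$, $J:\mathcal X\to\mathbb R_{\ge0}$) over $\mathbf x_k\in\mathbb R^n$, $u_k\in\mathbb R$, $\mathbf s_k\in\mathbb R^2$ subject to $\mathbf x_{k+1}=\mathbf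 A_k\mathbf x_k+\mathbf B_ku_k+\mathbf C_k$, $\mathbf x_0\in\mathbf x\oplus\mathcal E$, $\mathbf x_N=\mathbf 0$ and, for all $k=0,\dots,N-1$ and $i=0,\dots,2n-1$, $(\boldsymbol\zeta_k)_i\in\mathcal X\ominus\mathcal E$, $\|(\boldsymbol\zeta_k)_i-\overline{\mathbf x}_k\|_2\le s_{k,1}$, $|(\xi_k)_{n,i}-f(\overline{\mathbf x}_k)|\le s_{k,2}$, $\frac12\mathbf s_k^\top\mathbf M_{\alpha,\beta}\mathbf s_k+\mathbf N_{\alpha,\beta}(\overline{\mathbf x}_k)^\top\mathbf s_k+\Gamma_{\alpha,\beta}(\overline{\mathbf x}_k)\le u_{\max}$. *C-MPC.* At $t=0$ solve the FTOCP at $\mathbf x(0)$ with given linearization points, $\overline{\mathbf x}_{k|0}\in\mathcal X$. At each $t=iT$, $i\ge1$, solve it at $\mathbf x(iT)$ with linearization points $\overline{\mathbf x}_{k|i}=\mathbf x^*_{k+1|i-1}$ $(0\le k\le N-1)$ and $(\overline u_{k|i})_k=(u^*_{1|i-1},\dots,u^*_{N-1|i-1},0)$; if this is infeasible, solve it instead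 with the linearization points used at time $(i-1)T$, shifted by one and with the origin $(\mathbf 0,0)$ appended. Solving a feasible problem returns a minimizer if one exists and otherwise some feasible point. On $[iT,(i+1)T)$ apply $u=k^{\rm clf}_{\mathbf x_d|i}(\mathbf x,t)$, with $\mathbf x_d|i$ the reference started at $iT$ through $\mathbf x^*_{0|i},\dots,\mathbf x^*_{N|i}$. A closed-loop solution on an interval is a piecewise continuously differentiable function satisfying the resulting differential equation almost everywhere. **Theorem.** The functions $f$ and $1/g$ have least Lipschitz constants $\underline\alpha,\underline\beta\ge0$ on $\mathcal X$. Suppose that $\alpha\ge\underline\alpha$, $\beta\ge\underline\beta$, $\Gamma_{\alpha,\beta}(\mathbf 0)\le u_{\max}$, $\mathbf 0\in\mathcal X\ominus\mathcal E$, $\mathbf x(0)\in\mathcal X$, and that the FTOCP at $t=0$ is feasible. Let $\mathbf w$ be a piecewise continuous disturbance with $\|\mathbf w(t)\|_2\le\overline w$ for all $t\ge0$. Then: 1. For every $b\ge0$ and every closed-loop solution $\mathbf x$ on $[0,b]$: C-MPC is well-defined, that is, the FTOCP is feasible (if necessary with the shifted linearization points) at every update time $iT\le b$ and the quadratic program defining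 $k^{\rm clf}_{\mathbf x_d|i}(\mathbf x(t),t)$ has exactly one solution at every $t\in[0,b]$; moreover $\mathbf x(t)\in\mathcal X$ and $u(t)\in[-u_{\max},u_{\max}]$ for all $t\in[0,b]$. 2. If the controllers $k^{\rm clf}_{\mathbf x_d}$ are locally Lipschitz in the state uniformly in time (for all references $\mathbf x_d$ through $N+1$ points as above), then a closed-loop solution exists for all $t\ge0$. -/

import Mathlib

open Set Filter Topology MeasureTheory
open scoped NNReal

noncomputable section

namespace CMPC

/-- The state space `ℝⁿ` with the Euclidean norm. -/
abbrev State (n : ℕ) : Type := EuclideanSpace ℝ (Fin n)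

/-- A collection `(x̄ₖ, ūₖ)`, `k = 0, …, N-1`, of points around which the dynamics are
linearized. -/
abbrev Anchors (n N : ℕ) : Type := Fin N → State n × ℝ

/-! ### The system and the design data -/

/-- The nonlinear system (`f`, `g`) and the half-spaces `Lⱼᵀ x ≤ ℓⱼ` describing the state
constraints. -/
structure Plant (n q : ℕ) where
  f : State n → ℝ
  g : State n → ℝ
  L : Fin q → State n
  l : Fin q → ℝ

/-- The state constraint set `𝒳`. -/
def Plant.X {n q : ℕ} (S : Plant n q) : Set (State n) :=
  {x | ∀ j, inner ℝ (S.L j) x ≤ S.l j}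

/-- Standing assumptions on the system and on the state constraints. -/
structure Plant.Valid {n q : ℕ} (S : Plant n q) : Prop where
  f_contDiff : ContDiff ℝ 1 S.f
  g_contDiff : ContDiff ℝ 1 S.g
  f_zero : S.f 0 = 0
  g_ne_zero : ∀ x, S.g x ≠ 0
  compact : IsCompact S.X
  zero_mem_interior : (0 : State n) ∈ interior S.X

/-- The data of the two control layers: gain `K`, Lyapunov matrices `Q`, `P`, disturbance
bound, input bound, sampling period `T`, the parameters `α`, `β`, stage cost `h` and terminal
cost `J`. -/
structure Design (n : ℕ) where
  K : State n
  Q : Matrix (Fin n) (Fin n) ℝ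
  P : Matrix (Fin n) (Fin n) ℝ
  wbar : ℝ
  umax : ℝ
  T : ℝ
  α : ℝ
  β : ℝ
  h : State n → ℝ → ℝ
  J : State n → ℝ

/-- `chain x a = (x₂, …, xₙ, a)`, i.e. `[[0, I], [0, 0ᵀ]] x + (0, …, 0, a)`. -/
def chain {n : ℕ} (x : State n) (a : ℝ) : State n :=
  WithLp.toLp 2 fun j : Fin n => if hj : j.val + 1 < n then x ⟨j.val + 1, hj⟩ else a

/-- The error system matrix `F = [[0, I], [0, 0ᵀ]] - (0, …, 0, 1) Kᵀ` under feedback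
linearization. -/
def Design.F {n : ℕ} (D : Design n) : Matrix (Fin n) (Fin n) ℝ :=
  Matrix.of fun i j =>
    if i.val + 1 < n then (if j.val = i.val + 1 then 1 else 0) else - D.K j

/-- All (complex) eigenvalues have negative real part. -/
def IsHurwitz {n : ℕ} (A : Matrix (Fin n) (Fin n) ℝ) : Prop :=
  ∀ μ ∈ spectrum ℂ (A.map (algebraMap ℝ ℂ)), μ.re < 0

/-- Standing assumptions on the design data. -/
structure Design.Valid {n q : ℕ} (D : Design n) (S : Plant n q) : Prop where
  hurwitz : IsHurwitz D.F
  Q_posDef : D.Q.PosDef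
  P_posDef : D.P.PosDef
  lyapunov : D.F.transpose * D.P + D.P * D.F = - D.Q
  wbar_nonneg : 0 ≤ D.wbar
  umax_pos : 0 < D.umax
  T_pos : 0 < D.T
  h_nonneg : ∀ x ∈ S.X, ∀ u, 0 ≤ D.h x u
  h_convex : ConvexOn ℝ (S.X ×ˢ (univ : Set ℝ)) fun p => D.h p.1 p.2
  J_nonneg : ∀ x ∈ S.X, 0 ≤ D.J x
  J_convex : ConvexOn ℝ S.X D.J

/-- The smallest eigenvalue of a symmetric matrix. -/
def lambdaMin {n : ℕ} (A : Matrix (Fin n) (Fin n) ℝ) : ℝ := sInf (spectrum ℝ A)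

/-- The largest eigenvalue of a symmetric matrix. -/
def lambdaMax {n : ℕ} (A : Matrix (Fin n) (Fin n) ℝ) : ℝ := sSup (spectrum ℝ A)

/-- `γ = 4 λ_max(P)³ / λ_min(Q)²`. -/
def Design.γ {n : ℕ} (D : Design n) : ℝ := 4 * lambdaMax D.P ^ 3 / lambdaMin D.Q ^ 2

/-- The ellipsoid `ℰ = {v | vᵀ P v ≤ γ w̄²}`. -/
def Design.E {n : ℕ} (D : Design n) : Set (State n) :=
  {v | v.ofLp ⬝ᵥ D.P.mulVec v.ofLp ≤ D.γ * D.wbar ^ 2}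

/-- The Pontryagin (Minkowski) difference `A ⊖ B`. -/
def pontryaginDiff {n : ℕ} (A B : Set (State n)) : Set (State n) :=
  {x | ∀ v ∈ B, x + v ∈ A}

/-! ### The low-level controller -/

section LowLevel

variable {n q : ℕ} (S : Plant n q) (D : Design n)

/-- The drift `𝐟(x)`. -/
def Plant.drift (x : State n) : State n := chain x (S.f x)

/-- The input vector field `𝐠(x) = (0, …, 0, g(x))`. -/
def Plant.inputField (x : State n) : State n := chain 0 (S.g x)

/-- The feed-forward input `-g(x)⁻¹ (f(x) - v)`, where `v` is the last coordinate of the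
derivative of the reference. -/
def feedforward (x : State n) (v : ℝ) : ℝ := - (S.g x)⁻¹ * (S.f x - v)

/-- The inputs `u` that are admissible in the CLF quadratic program at state `x`, where the
reference is at `y` and the last coordinate of its derivative is `v`:
`∇V (𝐟_{x_d} + 𝐠(x) u) ≤ -λ_min(Q) ‖e‖²` with `e = x - y`, `∇V = 2 eᵀ P` and
`𝐟_{x_d} = [[0, I], [0, 0ᵀ]] e + (0, f(x) - v)`. -/
def clfConstraint (x y : State n) (v : ℝ) : Set ℝ :=
  {u | 2 * ((x - y).ofLp ⬝ᵥ
      D.P.mulVec (chain (x - y) (S.f x - v) + u • S.inputField x).ofLp)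
        ≤ - lambdaMin D.Q * ‖x - y‖ ^ 2}

/-- `u` solves the CLF quadratic program. -/
def IsCLFInput (x y : State n) (v u : ℝ) : Prop :=
  u ∈ clfConstraint S D x y v ∧
    ∀ u' ∈ clfConstraint S D x y v,
      (1 / 2) * ‖u - feedforward S x v‖ ^ 2 ≤ (1 / 2) * ‖u' - feedforward S x v‖ ^ 2

/-- The value of the CLF quadratic program controller. -/
def clfInput (x y : State n) (v : ℝ) : ℝ := Classical.epsilon (IsCLFInput S D x y v)

end LowLevel

/-! ### Bézier curves of order `2n - 1` -/

/-- The Bernstein polynomials `zᵢ(τ)` of order `2n - 1` on `[0, T]`. -/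
def bernsteinVec (n : ℕ) (T τ : ℝ) : Fin (2 * n) → ℝ := fun i =>
  ((2 * n - 1).choose i.val : ℝ) * (τ / T) ^ i.val * (1 - τ / T) ^ (2 * n - 1 - i.val)

/-- The differentiation matrix `S`. -/
def diffMatrix (n : ℕ) : Matrix (Fin (2 * n - 1)) (Fin (2 * n)) ℝ :=
  Matrix.of fun i j =>
    if j.val = i.val then - ((2 * n - 1 : ℕ) : ℝ)
    else if j.val = i.val + 1 then ((2 * n - 1 : ℕ) : ℝ) else 0

/-- The degree-raising matrix `R` (indices start at zero). -/
def raiseMatrix (n : ℕ) : Matrix (Fin (2 * n)) (Fin (2 * n - 1)) ℝ :=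
  Matrix.of fun i j =>
    if i.val = j.val then (((2 * n - 1 : ℕ) : ℝ) - j.val) / ((2 * n - 1 : ℕ) : ℝ)
    else if i.val = j.val + 1 then ((j.val : ℝ) + 1) / ((2 * n - 1 : ℕ) : ℝ) else 0

/-- `H = Sᵀ Rᵀ`. -/
def bezierH (n : ℕ) : Matrix (Fin (2 * n)) (Fin (2 * n)) ℝ :=
  (diffMatrix n).transpose * (raiseMatrix n).transpose

/-- `D = [D₀ D₁]`, the columns being `T⁻ʲ Hʲ z(0)` and then `T⁻ʲ Hʲ z(T)`, `j = 0, …, n-1`. -/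
def bezierD (n : ℕ) (T : ℝ) : Matrix (Fin (2 * n)) (Fin (2 * n)) ℝ :=
  Matrix.of fun i c =>
    if c.val < n then (1 / T ^ c.val) * (bezierH n ^ c.val).mulVec (bernsteinVec n T 0) i
    else (1 / T ^ (c.val - n)) * (bezierH n ^ (c.val - n)).mulVec (bernsteinVec n T T) i

/-- The row vector `[x₀ᵀ x₁ᵀ]`. -/
def joinStates {n : ℕ} (x₀ x₁ : State n) : Fin (2 * n) → ℝ := fun c =>
  if hc : c.val < n then x₀ ⟨c.val, hc⟩ else x₁ ⟨c.val - n, by omega⟩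

/-- Control points `ξ₀ᵀ = [x₀ᵀ x₁ᵀ] D⁻¹` of the curve joining `x₀` to `x₁`. -/
def ctrl {n : ℕ} (T : ℝ) (x₀ x₁ : State n) : Fin (2 * n) → ℝ :=
  Matrix.vecMul (joinStates x₀ x₁) (bezierD n T)⁻¹

/-- Control points `ξⱼᵀ = T⁻ʲ ξ₀ᵀ Hʲ` of the `j`-th derivative of the curve with control
points `ξ₀`. -/
def derivCtrl {n : ℕ} (T : ℝ) (ξ : Fin (2 * n) → ℝ) (j : ℕ) : Fin (2 * n) → ℝ :=
  (1 / T ^ j) • Matrix.vecMul ξ (bezierH n ^ j)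

/-- The state space control points `ζᵢ = (ξ_{0,i}, …, ξ_{n-1,i})`. -/
def zeta {n : ℕ} (T : ℝ) (ξ : Fin (2 * n) → ℝ) (i : Fin (2 * n)) : State n :=
  WithLp.toLp 2 fun j : Fin n => derivCtrl T ξ j.val i

/-- The `j`-th derivative `r⁽ʲ⁾(τ) = ξⱼᵀ z(τ)` of the Bézier curve with control points `ξ`. -/
def bezierDeriv {n : ℕ} (T : ℝ) (ξ : Fin (2 * n) → ℝ) (j : ℕ) (τ : ℝ) : ℝ :=
  derivCtrl T ξ j ⬝ᵥ bernsteinVec n T τ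

/-- The reference trajectory on `[t₀, t₀ + N T]` through the points `x₀, …, x_N`. -/
def refTraj {n N : ℕ} (T : ℝ) (x : Fin (N + 1) → State n) (t₀ t : ℝ) : State n :=
  if hk : ⌊(t - t₀) / T⌋₊ < N then
    WithLp.toLp 2 fun j : Fin n =>
      bezierDeriv T (ctrl T (x (Fin.castSucc ⟨⌊(t - t₀) / T⌋₊, hk⟩))
        (x (Fin.succ ⟨⌊(t - t₀) / T⌋₊, hk⟩))) j.val (t - t₀ - ⌊(t - t₀) / T⌋₊ * T)
  else x (Fin.last N)

/-- The last coordinate of the derivative of the reference trajectory, namely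
`r_k⁽ⁿ⁾(t - t_k)` on `[t_k, t_{k+1})`; the value at the right end point is immaterial. -/
def refDerivLast {n N : ℕ} (T : ℝ) (x : Fin (N + 1) → State n) (t₀ t : ℝ) : ℝ :=
  if hk : ⌊(t - t₀) / T⌋₊ < N then
    bezierDeriv T (ctrl T (x (Fin.castSucc ⟨⌊(t - t₀) / T⌋₊, hk⟩))
      (x (Fin.succ ⟨⌊(t - t₀) / T⌋₊, hk⟩))) n (t - t₀ - ⌊(t - t₀) / T⌋₊ * T)
  else 0

/-- The low-level controller `k^clf_{x_d}(x, t)` for the reference through the points `pts`. -/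
def trackingController {n q N : ℕ} (S : Plant n q) (D : Design n)
    (pts : Fin (N + 1) → State n) (t₀ : ℝ) (x : State n) (t : ℝ) : ℝ :=
  clfInput S D x (refTraj D.T pts t₀ t) (refDerivLast D.T pts t₀ t)

/-! ### The quantities entering the input constraint -/

/-- The projection of a symmetric matrix onto the cone of positive semidefinite matrices
(nearest point in the Frobenius norm): negative eigenvalues are replaced by zero. -/
def psdProj {m : ℕ} (A : Matrix (Fin m) (Fin m) ℝ) (hA : A.IsHermitian) :
    Matrix (Fin m) (Fin m) ℝ :=
  ∑ i, max (hA.eigenvalues i) 0 •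
    Matrix.vecMulVec (hA.eigenvectorBasis i).ofLp (hA.eigenvectorBasis i).ofLp

theorem tildeM_isHermitian (a b : ℝ) :
    (!![2 * a * b, b; b, 0] : Matrix (Fin 2) (Fin 2) ℝ).IsHermitian := by
  ext i j
  fin_cases i <;> fin_cases j <;> simp

section InputBound

variable {n q : ℕ} (S : Plant n q) (D : Design n)

def Design.M : Matrix (Fin 2) (Fin 2) ℝ :=
  psdProj !![2 * D.α * D.β, D.β; D.β, 0] (tildeM_isHermitian D.α D.β)

/-- `ē = √(γ w̄² / λ_min(P))`. -/
def Design.ebar : ℝ := Real.sqrt (D.γ * D.wbar ^ 2 / lambdaMin D.P)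

def Nvec (x : State n) : Fin 2 → ℝ :=
  ![2 * D.α * D.β * D.ebar + D.α * |(S.g x)⁻¹| + D.β * ‖D.K‖ * D.ebar,
    |(S.g x)⁻¹| + D.β * D.ebar]

def Gam (x : State n) : ℝ :=
  D.ebar * (D.β * D.ebar + |(S.g x)⁻¹|) * (D.α + ‖D.K‖)

end InputBound

/-! ### Linearization and exact discretization -/

section Lin

variable {n q : ℕ} (S : Plant n q) (T : ℝ)

/-- `A_c(x̄, ū) = ∂𝐟/∂x (x̄) + ∂𝐠/∂x (x̄) ū`. -/
def linAc (a : State n × ℝ) : State n →L[ℝ] State n :=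
  fderiv ℝ S.drift a.1 + a.2 • fderiv ℝ S.inputField a.1

/-- `C_c(x̄, ū)`. -/
def linCc (a : State n × ℝ) : State n :=
  S.drift a.1 + a.2 • S.inputField a.1 - linAc S a a.1 - a.2 • S.inputField a.1

def linA (a : State n × ℝ) : State n →L[ℝ] State n := NormedSpace.exp (T • linAc S a)

def linB (a : State n × ℝ) : State n :=
  ∫ τ in (0 : ℝ)..T, NormedSpace.exp ((T - τ) • linAc S a) (S.inputField a.1)

def linC (a : State n × ℝ) : State n :=
  ∫ τ in (0 : ℝ)..T, NormedSpace.exp ((T - τ) • linAc S a) (linCc S a)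

end Lin

/-! ### The finite time optimal control problem -/

/-- The decision variables of the FTOCP. -/
structure Plan (n N : ℕ) where
  x : Fin (N + 1) → State n
  u : Fin N → ℝ
  s : Fin N → Fin 2 → ℝ
  ξ : Fin N → Fin (2 * n) → ℝ

/-- The constraints of the FTOCP for the linearization points `a` and current state `x`. -/
structure IsFeasible {n q N : ℕ} (S : Plant n q) (D : Design n) (a : Anchors n N)
    (x : State n) (p : Plan n N) : Prop where
  dynamics : ∀ k : Fin N,
    p.x k.succ = linA S D.T (a k) (p.x k.castSucc) + p.u k • linB S D.T (a k) + linC S D.T (a k)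
  initial : ∃ v ∈ D.E, p.x 0 = x + v
  terminal : p.x (Fin.last N) = 0
  bezier : ∀ k : Fin N, p.ξ k = ctrl D.T (p.x k.castSucc) (p.x k.succ)
  hull : ∀ (k : Fin N) (i : Fin (2 * n)), zeta D.T (p.ξ k) i ∈ pontryaginDiff S.X D.E
  conic_state : ∀ (k : Fin N) (i : Fin (2 * n)),
    ‖zeta D.T (p.ξ k) i - (a k).1‖ ≤ p.s k 0
  conic_deriv : ∀ (k : Fin N) (i : Fin (2 * n)),
    ‖derivCtrl D.T (p.ξ k) n i - S.f (a k).1‖ ≤ p.s k 1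
  quadratic : ∀ k : Fin N,
    (1 / 2) * (p.s k ⬝ᵥ D.M.mulVec (p.s k)) + Nvec S D (a k).1 ⬝ᵥ p.s k + Gam S D (a k).1
      ≤ D.umax

/-- The FTOCP is feasible. -/
def FTOCPFeasible {n q N : ℕ} (S : Plant n q) (D : Design n) (a : Anchors n N)
    (x : State n) : Prop :=
  ∃ p, IsFeasible S D a x p

/-- The cost of the FTOCP. -/
def cost {n N : ℕ} (D : Design n) (p : Plan n N) : ℝ :=
  ∑ k : Fin N, D.h (p.x k.castSucc) (p.u k) + D.J (p.x (Fin.last N))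

/-- `p` is a minimizer of the FTOCP. -/
def IsOptimal {n q N : ℕ} (S : Plant n q) (D : Design n) (a : Anchors n N)
    (x : State n) (p : Plan n N) : Prop :=
  IsFeasible S D a x p ∧ ∀ p', IsFeasible S D a x p' → cost D p ≤ cost D p'

/-- `σ i a x` is the result of solving, at the `i`-th update, the FTOCP for the linearization
points `a` and current state `x`. Whenever the problem is feasible, the result is a minimizer if
there is one, and some feasible point otherwise. Nothing is required of infeasible problems. -/
def IsSolver {n q N : ℕ} (S : Plant n q) (D : Design n)
    (σ : ℕ → Anchors n N → State n → Plan n N) : Prop :=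
  ∀ i a x, FTOCPFeasible S D a x →
    IsFeasible S D a x (σ i a x) ∧
      ((∃ p, IsOptimal S D a x p) → IsOptimal S D a x (σ i a x))

/-! ### The multi-rate algorithm and its closed loop -/

/-- `{a₁, …, a_{N-1}, (0, 0)}`: linearization points shifted by one, with the origin appended. -/
def shiftAnchors {n N : ℕ} (a : Anchors n N) : Anchors n N := fun k =>
  if hk : k.val + 1 < N then a ⟨k.val + 1, hk⟩ else (0, 0)

/-- `x̄ = {x*₁, …, x*_N}` and `ū = {u*₁, …, u*_{N-1}, 0}`. -/
def nextAnchors {n N : ℕ} (p : Plan n N) : Anchors n N := fun k =>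
  (p.x k.succ, if hk : k.val + 1 < N then p.u ⟨k.val + 1, hk⟩ else 0)

open Classical in
/-- The updates of the algorithm along a state trajectory `φ`: the linearization points finally
used at time `i T` and the result of the FTOCP. If the FTOCP with the linearizations about the
previous solution is infeasible, the previously used linearizations are shifted by one and the
linearization about the origin is appended. -/
def run {n q N : ℕ} (S : Plant n q) (D : Design n)
    (σ : ℕ → Anchors n N → State n → Plan n N) (a₀ : Anchors n N) (φ : ℝ → State n) :
    ℕ → Anchors n N × Plan n N
  | 0 => (a₀, σ 0 a₀ (φ 0))
  | i + 1 =>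
    let prev := run S D σ a₀ φ i
    let x := φ ((i + 1 : ℕ) * D.T)
    let a := if FTOCPFeasible S D (nextAnchors prev.2) x then nextAnchors prev.2
      else shiftAnchors prev.1
    (a, σ (i + 1) a x)

/-- The points `x*_{k|i}` planned at the last update time before (or at) `t`. -/
def activePoints {n q N : ℕ} (S : Plant n q) (D : Design n)
    (σ : ℕ → Anchors n N → State n → Plan n N) (a₀ : Anchors n N) (φ : ℝ → State n)
    (t : ℝ) : Fin (N + 1) → State n :=
  (run S D σ a₀ φ ⌊t / D.T⌋₊).2.x

/-- The input applied at time `t` in state `φ t`. -/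
def cmpcInput {n q N : ℕ} (S : Plant n q) (D : Design n)
    (σ : ℕ → Anchors n N → State n → Plan n N) (a₀ : Anchors n N) (φ : ℝ → State n)
    (t : ℝ) : ℝ :=
  trackingController S D (activePoints S D σ a₀ φ t) (⌊t / D.T⌋₊ * D.T) (φ t) t

/-- The CLF quadratic program that defines the input at time `t` in state `φ t` has exactly one
solution. -/
def CLFWellPosed {n q N : ℕ} (S : Plant n q) (D : Design n)
    (σ : ℕ → Anchors n N → State n → Plan n N) (a₀ : Anchors n N) (φ : ℝ → State n)
    (t : ℝ) : Prop :=
  ∃! u, IsCLFInput S D (φ t)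
    (refTraj D.T (activePoints S D σ a₀ φ t) (⌊t / D.T⌋₊ * D.T) t)
    (refDerivLast D.T (activePoints S D σ a₀ φ t) (⌊t / D.T⌋₊ * D.T) t) u

/-- Piecewise continuity on `[0, ∞)`: finitely many discontinuities in bounded intervals, and
one-sided limits everywhere. -/
def PiecewiseContinuous {n : ℕ} (w : ℝ → State n) : Prop :=
  (∀ b : ℝ, {t ∈ Ioc 0 b | ¬ ContinuousAt w t}.Finite) ∧
    (∀ t, 0 ≤ t → ∃ y, Tendsto w (𝓝[>] t) (𝓝 y)) ∧
    ∀ t, 0 < t → ∃ y, Tendsto w (𝓝[<] t) (𝓝 y)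

/-- Piecewise continuous differentiability on `[0, b]`. -/
def PiecewiseC1 {n : ℕ} (φ : ℝ → State n) (b : ℝ) : Prop :=
  ContinuousOn φ (Icc 0 b) ∧
    (∃ Z : Set ℝ, Z.Finite ∧ ∀ t ∈ Ioo 0 b \ Z,
      DifferentiableAt ℝ φ t ∧ ContinuousAt (deriv φ) t) ∧
    (∀ t ∈ Ico 0 b, ∃ y, Tendsto (deriv φ) (𝓝[>] t) (𝓝 y)) ∧
    ∀ t ∈ Ioc 0 b, ∃ y, Tendsto (deriv φ) (𝓝[<] t) (𝓝 y)

/-- `φ` is a solution on `[0, b]` of the closed loop with initial state `x₀` and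
disturbance `w`. -/
structure IsClosedLoop {n q N : ℕ} (S : Plant n q) (D : Design n)
    (σ : ℕ → Anchors n N → State n → Plan n N) (a₀ : Anchors n N) (w : ℝ → State n)
    (x₀ : State n) (φ : ℝ → State n) (b : ℝ) : Prop where
  initial : φ 0 = x₀
  piecewiseC1 : PiecewiseC1 φ b
  ode : ∀ᵐ t ∂(volume.restrict (Ioo 0 b)),
    HasDerivAt φ (S.drift (φ t) + cmpcInput S D σ a₀ φ t • S.inputField (φ t) + w t) t

/-- `k` is locally Lipschitz in the state, uniformly in time `t ∈ I`. -/
def LocallyLipschitzInState {n : ℕ} (k : State n → ℝ → ℝ) (I : Set ℝ) : Prop :=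
  ∀ x, ∃ C : ℝ≥0, ∃ U ∈ 𝓝 x, ∀ t ∈ I, LipschitzOnWith C (fun y => k y t) U

/-- The low-level controllers belong to the class of feedback laws for which the closed loop is
set up. -/
def ControllerRegular {n q : ℕ} (S : Plant n q) (D : Design n) (N : ℕ) : Prop :=
  ∀ (pts : Fin (N + 1) → State n) (t₀ : ℝ), 0 ≤ t₀ →
    LocallyLipschitzInState (trackingController S D pts t₀) (Icc t₀ (t₀ + N * D.T))

end CMPC

end

open CMPC

namespace CMPC

/-! The quadratic program has a one-dimensional decision variable, so it can be solved by hand. In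
terms of the residual `r = f(x) - v + g(x) u`, its cost is a multiple of `r²` and its constraint is
a half-line depending only on the error `e`. The minimizer is therefore `r = -ψ(e)` with an explicit
`ψ`, `Design.psi` (`isCLFInput_iff`). Under this input `f`, `g` and the reference cancel, and the
error obeys `e' = (e₂, …, eₙ, -ψ(e)) + w`. Everything else rests on this reduction.

Safety: the Lyapunov equation makes `V = eᵀPe` nonincreasing outside the ellipsoid `ℰ`, which is
thus invariant (`Design.Valid.sub_mem_E`). Since each plan starts in `x ⊕ ℰ`, the error stays in `ℰ`
for one sampling period. Bézier curves lie in the convex hull of their control points, so the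
constraints imposed on control points hold along the whole reference. Tightening by `ℰ` gives the
state constraint. The Lipschitz bounds on `f` and `1/g` about the linearization point bound the
input by a product of two affine functions of `s`, which the quadratic constraint dominates
(`mul_abs_le_conic`, `IsFeasible.constraints`). The accuracy of the linearized dynamics plays no
role here.

Recursive feasibility: at the end of a period the state is within `ℰ` of the next planned point, so
the tail of the plan, followed by rest at the origin, is feasible for the shifted linearizations
(`IsFeasible.shift`). Induction over the updates covers both branches of the algorithm
(`IsClosedLoop.run_feasible`).

Existence: regularity of the controller for the zero reference makes `ψ` Lipschitz near `0`. Since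
`ψ` is positively homogeneous of degree one, it is globally Lipschitz (`exists_psi_lipschitz`). The
error equation can then be solved over each period by Picard–Lindelöf, and the pieces are
concatenated. The updates see the trajectory only at the sampling instants, so plans and pieces can
be built in turn (`exists_isClosedLoop`). -/

/-! ### Bilinear forms given by symmetric matrices -/

/-- The bilinear form `xᵀ A y`. -/
def bform {n : ℕ} (A : Matrix (Fin n) (Fin n) ℝ) (x y : State n) : ℝ :=
  x.ofLp ⬝ᵥ A.mulVec y.ofLp

section bform

variable {n : ℕ} {A : Matrix (Fin n) (Fin n) ℝ}

theorem bform_add_right (x y z : State n) : bform A x (y + z) = bform A x y + bform A x z := by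
  simp [bform, Matrix.mulVec_add, dotProduct_add]

theorem bform_smul_left (c : ℝ) (x y : State n) : bform A (c • x) y = c * bform A x y := by
  simp [bform, smul_dotProduct]

theorem bform_smul_right (c : ℝ) (x y : State n) : bform A x (c • y) = c * bform A x y := by
  simp [bform, Matrix.mulVec_smul, dotProduct_smul]

theorem bform_neg (x : State n) : bform A (-x) (-x) = bform A x x := by
  simp [bform, Matrix.mulVec_neg]

theorem bform_transpose (x y : State n) : bform A.transpose x y = bform A y x := by
  simp only [bform, Matrix.mulVec_transpose]
  rw [dotProduct_comm, Matrix.dotProduct_mulVec]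

theorem bform_comm (hA : A.IsHermitian) (x y : State n) : bform A x y = bform A y x := by
  rw [← bform_transpose]
  congr 1

theorem continuous_bform : Continuous fun p : State n × State n => bform A p.1 p.2 := by
  unfold bform dotProduct Matrix.mulVec dotProduct
  fun_prop

/-- Spectral theorem in eigencoordinates. The eigenvalue estimates below, and the comparison with
the semidefinite projection, follow from it term by term. -/
theorem bform_eq_sum (hA : A.IsHermitian) (x y : State n) :
    bform A x y = ∑ i, hA.eigenvalues i *
      (inner ℝ (hA.eigenvectorBasis i) x * inner ℝ (hA.eigenvectorBasis i) y) := by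
  have h1 : bform A x y = inner ℝ x (WithLp.toLp 2 (A.mulVec y.ofLp) : State n) := by
    rw [EuclideanSpace.inner_eq_star_dotProduct, dotProduct_comm]
    simp [bform]
  rw [h1, ← hA.eigenvectorBasis.sum_inner_mul_inner]
  refine Finset.sum_congr rfl fun i _ => ?_
  have h2 : inner ℝ (hA.eigenvectorBasis i) (WithLp.toLp 2 (A.mulVec y.ofLp) : State n)
      = hA.eigenvalues i * inner ℝ (hA.eigenvectorBasis i) y := by
    have h3 : inner ℝ (hA.eigenvectorBasis i) (WithLp.toLp 2 (A.mulVec y.ofLp) : State n)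
        = bform A (hA.eigenvectorBasis i) y := by
      rw [EuclideanSpace.inner_eq_star_dotProduct, dotProduct_comm]
      simp [bform]
    rw [h3, bform_comm hA, bform, hA.mulVec_eigenvectorBasis, dotProduct_smul,
      EuclideanSpace.inner_eq_star_dotProduct]
    simp
  rw [h2, real_inner_comm]
  ring

theorem sum_sq_inner_eigenvectorBasis (hA : A.IsHermitian) (x : State n) :
    ∑ i, inner ℝ (hA.eigenvectorBasis i) x ^ 2 = ‖x‖ ^ 2 := by
  rw [← hA.eigenvectorBasis.sum_sq_norm_inner_right x]
  simp

theorem lambdaMin_le_eigenvalues (hA : A.IsHermitian) (i : Fin n) :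
    lambdaMin A ≤ hA.eigenvalues i := by
  rw [lambdaMin, hA.spectrum_real_eq_range_eigenvalues]
  exact csInf_le (finite_range _).bddBelow ⟨i, rfl⟩

theorem eigenvalues_le_lambdaMax (hA : A.IsHermitian) (i : Fin n) :
    hA.eigenvalues i ≤ lambdaMax A := by
  rw [lambdaMax, hA.spectrum_real_eq_range_eigenvalues]
  exact le_csSup (finite_range _).bddAbove ⟨i, rfl⟩

theorem lambdaMin_pos (hn : 0 < n) (hA : A.PosDef) : 0 < lambdaMin A := by
  have : Nonempty (Fin n) := ⟨⟨0, hn⟩⟩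
  rw [lambdaMin, hA.1.spectrum_real_eq_range_eigenvalues]
  obtain ⟨i, hi⟩ := (range_nonempty hA.1.eigenvalues).csInf_mem (finite_range _)
  rw [← hi]
  exact hA.eigenvalues_pos i

theorem lambdaMax_pos (hn : 0 < n) (hA : A.PosDef) : 0 < lambdaMax A :=
  (hA.eigenvalues_pos ⟨0, hn⟩).trans_le (eigenvalues_le_lambdaMax hA.1 _)

theorem lambdaMin_mul_le_bform (hA : A.IsHermitian) (x : State n) :
    lambdaMin A * ‖x‖ ^ 2 ≤ bform A x x := by
  rw [bform_eq_sum hA, ← sum_sq_inner_eigenvectorBasis hA, Finset.mul_sum]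
  refine Finset.sum_le_sum fun i _ => ?_
  rw [← sq]
  exact mul_le_mul_of_nonneg_right (lambdaMin_le_eigenvalues hA i) (sq_nonneg _)

theorem bform_le_lambdaMax_mul (hA : A.IsHermitian) (x : State n) :
    bform A x x ≤ lambdaMax A * ‖x‖ ^ 2 := by
  rw [bform_eq_sum hA, ← sum_sq_inner_eigenvectorBasis hA, Finset.mul_sum]
  refine Finset.sum_le_sum fun i _ => ?_
  rw [← sq]
  exact mul_le_mul_of_nonneg_right (eigenvalues_le_lambdaMax hA i) (sq_nonneg _)

/-- Cauchy–Schwarz in eigencoordinates, after replacing each positive eigenvalue by the largest one.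
-/
theorem bform_le_lambdaMax_mul_norm (hn : 0 < n) (hA : A.PosDef) (x y : State n) :
    bform A x y ≤ lambdaMax A * (‖x‖ * ‖y‖) := by
  have h1 : bform A x y ≤ lambdaMax A * ∑ i, |inner ℝ (hA.1.eigenvectorBasis i) x| *
      |inner ℝ (hA.1.eigenvectorBasis i) y| := by
    rw [bform_eq_sum hA.1, Finset.mul_sum]
    refine Finset.sum_le_sum fun i _ => ?_
    rw [← abs_mul]
    exact (mul_le_mul_of_nonneg_left (le_abs_self _) (hA.eigenvalues_pos i).le).trans
      (mul_le_mul_of_nonneg_right (eigenvalues_le_lambdaMax hA.1 i) (abs_nonneg _))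
  refine h1.trans (mul_le_mul_of_nonneg_left ?_ (lambdaMax_pos hn hA).le)
  refine (Real.sum_mul_le_sqrt_mul_sqrt _ _ _).trans (le_of_eq ?_)
  simp_rw [sq_abs, sum_sq_inner_eigenvectorBasis, Real.sqrt_sq (norm_nonneg _)]

end bform

/-- The projection keeps the eigenvectors and only raises eigenvalues. The indefinite form of the
input bound may thus be replaced by a convex majorant. -/
theorem dotProduct_mulVec_le_psdProj {m : ℕ} (A : Matrix (Fin m) (Fin m) ℝ) (hA : A.IsHermitian)
    (s : Fin m → ℝ) : s ⬝ᵥ A.mulVec s ≤ s ⬝ᵥ (psdProj A hA).mulVec s := by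
  have h1 := bform_eq_sum hA (WithLp.toLp 2 s) (WithLp.toLp 2 s)
  have h2 : s ⬝ᵥ A.mulVec s = bform A (WithLp.toLp 2 s) (WithLp.toLp 2 s) := rfl
  rw [h2, h1, psdProj, Matrix.sum_mulVec, dotProduct_sum]
  refine Finset.sum_le_sum fun i _ => ?_
  rw [Matrix.smul_mulVec, dotProduct_smul, Matrix.vecMulVec_mulVec]
  have h3 : inner ℝ (hA.eigenvectorBasis i) (WithLp.toLp 2 s : State m)
      = s ⬝ᵥ (hA.eigenvectorBasis i).ofLp := by
    rw [EuclideanSpace.inner_eq_star_dotProduct]; simp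
  rw [h3, smul_eq_mul]
  have h4 : s ⬝ᵥ (MulOpposite.op ((hA.eigenvectorBasis i).ofLp ⬝ᵥ s) • (hA.eigenvectorBasis i).ofLp)
      = (s ⬝ᵥ (hA.eigenvectorBasis i).ofLp) * (s ⬝ᵥ (hA.eigenvectorBasis i).ofLp) := by
    rw [op_smul_eq_smul, dotProduct_smul, smul_eq_mul, dotProduct_comm s]
  rw [h4]
  exact mul_le_mul_of_nonneg_right (le_max_left _ _) (mul_self_nonneg _)

/-! ### Bernstein polynomials and Bézier curves -/

section Bezier

open Polynomial

/-- The Bernstein polynomials of degree `2n - 1`. -/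
noncomputable def bern (n : ℕ) (i : Fin (2 * n)) : ℝ[X] :=
  bernsteinPolynomial ℝ (2 * n - 1) i

theorem bernsteinVec_eq (n : ℕ) (T τ : ℝ) (i : Fin (2 * n)) :
    bernsteinVec n T τ i = (bern n i).eval (τ / T) := by
  simp [bernsteinVec, bern, bernsteinPolynomial]

/-- Degree elevation: multiply the degree `d` polynomial by `(1 - X) + X = 1`. For `j = d + 1` the
only surviving polynomial has coefficient zero. -/
theorem bernsteinPolynomial_raise (d j : ℕ) :
    ((((d + 1 : ℕ) : ℝ) - (j : ℝ)) / ((d + 1 : ℕ) : ℝ)) • bernsteinPolynomial ℝ (d + 1) j +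
      (((j : ℝ) + 1) / ((d + 1 : ℕ) : ℝ)) • bernsteinPolynomial ℝ (d + 1) (j + 1) =
      bernsteinPolynomial ℝ d j := by
  rcases lt_or_ge d j with h | h
  · rcases eq_or_lt_of_le (Nat.succ_le_of_lt h) with h' | h'
    · subst h'
      simp [bernsteinPolynomial]
    · rw [bernsteinPolynomial.eq_zero_of_lt ℝ h, bernsteinPolynomial.eq_zero_of_lt ℝ h',
        bernsteinPolynomial.eq_zero_of_lt ℝ (by omega : d + 1 < j + 1)]
      simp
  · obtain ⟨c, rfl⟩ := Nat.exists_eq_add_of_le h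
    have e1 : ((j + c + 1 : ℕ) : ℝ) ≠ 0 := by positivity
    have h1 : (((j + c + 1 : ℕ) : ℝ) - j) / ((j + c + 1 : ℕ) : ℝ) * ((j + c + 1).choose j : ℝ)
        = ((j + c).choose j : ℝ) := by
      have := Nat.choose_mul_succ_eq (j + c) j
      have h2 : ((j + c).choose j : ℝ) * ((j + c + 1 : ℕ) : ℝ)
          = ((j + c + 1).choose j : ℝ) * ((j + c + 1 - j : ℕ) : ℝ) := by exact_mod_cast this
      rw [Nat.cast_sub (by omega)] at h2
      field_simp
      linarith
    have h3 : ((j : ℝ) + 1) / ((j + c + 1 : ℕ) : ℝ) * ((j + c + 1).choose (j + 1) : ℝ)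
        = ((j + c).choose j : ℝ) := by
      have := Nat.add_one_mul_choose_eq (j + c) j
      have h2 : ((j + c + 1 : ℕ) : ℝ) * ((j + c).choose j : ℝ)
          = ((j + c + 1).choose (j + 1) : ℝ) * ((j : ℝ) + 1) := by exact_mod_cast this
      field_simp
      linarith
    simp only [bernsteinPolynomial, smul_eq_C_mul]
    have e2 : j + c + 1 - j = c + 1 := by omega
    have e3 : j + c + 1 - (j + 1) = c := by omega
    have e4 : j + c - j = c := by omega
    rw [e2, e3, e4]
    have h1' := congrArg (C : ℝ → ℝ[X]) h1
    have h3' := congrArg (C : ℝ → ℝ[X]) h3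
    rw [C_mul, C_eq_natCast, C_eq_natCast] at h1' h3'
    calc _ = (C ((((j + c + 1 : ℕ) : ℝ) - j) / ((j + c + 1 : ℕ) : ℝ)) *
          ((j + c + 1).choose j : ℝ[X])) * X ^ j * (1 - X) ^ (c + 1) +
          (C (((j : ℝ) + 1) / ((j + c + 1 : ℕ) : ℝ)) * ((j + c + 1).choose (j + 1) : ℝ[X])) *
            X ^ (j + 1) * (1 - X) ^ c := by ring
      _ = _ := by rw [h1', h3']; ring

theorem sum_raiseMatrix_smul_bern {n : ℕ} (hn : 0 < n) (j : Fin (2 * n - 1)) :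
    ∑ k, raiseMatrix n k j • bern n k = bernsteinPolynomial ℝ (2 * n - 2) j := by
  have hj := j.isLt
  rw [Fintype.sum_eq_add (⟨j, by omega⟩ : Fin (2 * n)) ⟨j + 1, by omega⟩ (by simp)]
  · have h := bernsteinPolynomial_raise (2 * n - 2) j
    have e : 2 * n - 2 + 1 = 2 * n - 1 := by omega
    rw [e] at h
    simpa [raiseMatrix, bern] using h
  · rintro k ⟨h1, h2⟩
    have h1' : k.val ≠ j.val := fun h => h1 (Fin.ext h)
    have h2' : k.val ≠ j.val + 1 := fun h => h2 (Fin.ext h)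
    simp [raiseMatrix, h1', h2']

theorem sum_diffMatrix_smul {n : ℕ} (hn : 0 < n) (i : Fin (2 * n)) :
    ∑ j, diffMatrix n j i • bernsteinPolynomial ℝ (2 * n - 2) j = derivative (bern n i) := by
  -- Extending the summand to all natural indices turns the matrix sum into a range sum with two
  -- Kronecker deltas.
  let F : ℕ → ℝ[X] := fun j =>
    (if i.val = j then - ((2 * n - 1 : ℕ) : ℝ[X]) * bernsteinPolynomial ℝ (2 * n - 2) j else 0) +
      (if i.val = j + 1 then ((2 * n - 1 : ℕ) : ℝ[X]) * bernsteinPolynomial ℝ (2 * n - 2) j else 0)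
  have h0 : ∀ j : Fin (2 * n - 1),
      diffMatrix n j i • bernsteinPolynomial ℝ (2 * n - 2) j = F j := by
    intro j
    by_cases h1 : i.val = j.val
    · have h2 : ¬ (i.val = j.val + 1) := by omega
      simp only [F, diffMatrix, Matrix.of_apply, if_pos h1, if_neg h2, smul_eq_C_mul]
      simp
    · simp only [F, diffMatrix, Matrix.of_apply, if_neg h1, smul_eq_C_mul]
      split_ifs <;> simp
  have hi := i.isLt
  rw [Finset.sum_congr rfl fun j _ => h0 j,
    Fin.sum_univ_eq_sum_range F, Finset.sum_add_distrib, Finset.sum_ite_eq]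
  obtain ⟨i, hi'⟩ := i
  rcases i with _ | i
  · have : 0 < 2 * n - 1 := by omega
    simp [bern, bernsteinPolynomial.derivative_zero, this, Nat.sub_sub]
  · have e : ∀ j, (i + 1 = j + 1) ↔ i = j := fun j => by omega
    have h2 : i < 2 * n - 1 := by omega
    simp only [bern, bernsteinPolynomial.derivative_succ, e, Finset.sum_ite_eq, Finset.mem_range,
      h2, if_true, Nat.sub_sub]
    -- At the last index the subtracted term is absent from the range, in agreement with the
    -- vanishing of that Bernstein polynomial of degree `2n - 2`.
    split_ifs with h
    · ring
    · rw [bernsteinPolynomial.eq_zero_of_lt ℝ (by omega : 2 * n - 2 < i + 1)]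
      simp

/-- This explains `H = SᵀRᵀ`: `S` differentiates into degree `2n - 2`, and `R` raises the degree
back to `2n - 1`. -/
theorem derivative_bern {n : ℕ} (hn : 0 < n) (i : Fin (2 * n)) :
    derivative (bern n i) = ∑ k, bezierH n i k • bern n k := by
  simp only [bezierH, Matrix.mul_apply, Matrix.transpose_apply, Finset.sum_smul]
  rw [Finset.sum_comm, ← sum_diffMatrix_smul hn]
  refine Finset.sum_congr rfl fun j _ => ?_
  rw [← sum_raiseMatrix_smul_bern hn, Finset.smul_sum]
  simp only [smul_smul]

/-- The polynomial with given Bernstein coefficients. -/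
noncomputable def bernSum {n : ℕ} (ξ : Fin (2 * n) → ℝ) : ℝ[X] := ∑ i, ξ i • bern n i

theorem derivative_bernSum {n : ℕ} (hn : 0 < n) (ξ : Fin (2 * n) → ℝ) :
    derivative (bernSum ξ) = bernSum (Matrix.vecMul ξ (bezierH n)) := by
  simp only [bernSum, map_sum, derivative_smul, derivative_bern hn, Matrix.vecMul, dotProduct,
    Finset.sum_smul, Finset.smul_sum, smul_smul]
  rw [Finset.sum_comm]

theorem iterate_derivative_bernSum {n : ℕ} (hn : 0 < n) (ξ : Fin (2 * n) → ℝ) (j : ℕ) :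
    derivative^[j] (bernSum ξ) = bernSum (Matrix.vecMul ξ (bezierH n ^ j)) := by
  induction j with
  | zero => simp
  | succ j ih =>
    rw [Function.iterate_succ_apply', ih, derivative_bernSum hn, Matrix.vecMul_vecMul, pow_succ]

/-- Triangularity at `0`: the `k`-th derivative of the `i`-th Bernstein polynomial vanishes there
for `i > k` but not for `i = k`, so the coefficients vanish one after another. -/
theorem bernSum_injective {n : ℕ} (ξ : Fin (2 * n) → ℝ) (h : bernSum ξ = 0) : ξ = 0 := by
  have key : ∀ k : ℕ, ∀ i : Fin (2 * n), i.val = k → ξ i = 0 := by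
    intro k
    induction k using Nat.strong_induction_on with
    | _ k ih =>
      intro i hi
      have h1 : (derivative^[k] (bernSum ξ)).eval 0 = 0 := by rw [h]; simp
      rw [bernSum, iterate_derivative_sum, eval_finsetSum, Finset.sum_eq_single i] at h1
      · rw [iterate_derivative_smul, eval_smul, smul_eq_mul, ← hi] at h1
        exact (mul_eq_zero.1 h1).resolve_right
          (bernsteinPolynomial.iterate_derivative_at_0_ne_zero ℝ _ _ (by omega))
      · intro b _ hb
        rw [iterate_derivative_smul, eval_smul]
        have hb' : b.val ≠ k := fun h' => hb (Fin.ext (h'.trans hi.symm))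
        rcases lt_or_gt_of_ne hb' with h' | h'
        · rw [ih b h' b rfl, zero_smul]
        · rw [bern, bernsteinPolynomial.iterate_derivative_at_0_eq_zero_of_lt ℝ _ h', smul_zero]
      · simp
  funext i
  exact key i i rfl

theorem natDegree_bernSum_le {n : ℕ} (ξ : Fin (2 * n) → ℝ) :
    (bernSum ξ).natDegree ≤ 2 * n - 1 := by
  refine natDegree_sum_le_of_forall_le _ _ fun i _ => (natDegree_smul_le _ _).trans ?_
  have hi := i.isLt
  unfold bern bernsteinPolynomial
  refine natDegree_mul_le.trans ?_
  have h1 : ((1 - X : ℝ[X]) ^ (2 * n - 1 - i.val)).natDegree ≤ (2 * n - 1 - i.val) * 1 := by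
    refine natDegree_pow_le_of_le _ ((natDegree_sub_le _ _).trans ?_)
    simp
  have h2 : (((2 * n - 1).choose i.val : ℝ[X]) * X ^ i.val).natDegree ≤ i.val := by
    refine natDegree_mul_le.trans ?_
    simp
  omega

theorem bernSum_eval_eq {n : ℕ} (ξ : Fin (2 * n) → ℝ) (T τ : ℝ) :
    (bernSum ξ).eval (τ / T) = ξ ⬝ᵥ bernsteinVec n T τ := by
  simp [bernSum, eval_finsetSum, dotProduct, bernsteinVec_eq]

/-- The control-point formula is an honest derivative: powers of `H` differentiate in `τ / T`, and
the chain rule supplies the powers of `1 / T`. -/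
theorem bezierDeriv_eq {n : ℕ} (hn : 0 < n) (T : ℝ) (ξ : Fin (2 * n) → ℝ) (j : ℕ) (τ : ℝ) :
    bezierDeriv T ξ j τ = (1 / T ^ j) * (derivative^[j] (bernSum ξ)).eval (τ / T) := by
  rw [iterate_derivative_bernSum hn, bernSum_eval_eq, bezierDeriv, derivCtrl, smul_dotProduct,
    smul_eq_mul]

theorem hasDerivAt_bezierDeriv {n : ℕ} (hn : 0 < n) (T : ℝ) (ξ : Fin (2 * n) → ℝ) (j : ℕ)
    (τ : ℝ) : HasDerivAt (bezierDeriv T ξ j) (bezierDeriv T ξ (j + 1) τ) τ := by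
  have h0 : bezierDeriv T ξ j =
      fun τ => (1 / T ^ j) * (derivative^[j] (bernSum ξ)).eval (τ / T) :=
    funext fun τ => bezierDeriv_eq hn T ξ j τ
  rw [h0, bezierDeriv_eq hn, Function.iterate_succ_apply']
  have h1 := ((derivative^[j] (bernSum ξ)).hasDerivAt (τ / T)).comp τ
    ((hasDerivAt_id τ).div_const T)
  refine (h1.const_mul (1 / T ^ j)).congr_deriv ?_
  rw [pow_succ, ← one_div_mul_one_div]
  ring

theorem continuous_bezierDeriv {n : ℕ} (hn : 0 < n) (T : ℝ) (ξ : Fin (2 * n) → ℝ) (j : ℕ) :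
    Continuous (bezierDeriv T ξ j) :=
  continuous_iff_continuousAt.2 fun τ => (hasDerivAt_bezierDeriv hn T ξ j τ).continuousAt

theorem vecMul_bezierD {n : ℕ} (T : ℝ) (ξ : Fin (2 * n) → ℝ) (c : Fin (2 * n)) :
    Matrix.vecMul ξ (bezierD n T) c =
      if c.val < n then bezierDeriv T ξ c.val 0 else bezierDeriv T ξ (c.val - n) T := by
  have key : ∀ (j : ℕ) (τ : ℝ),
      ∑ i, ξ i * ((1 / T ^ j) * (bezierH n ^ j).mulVec (bernsteinVec n T τ) i)
        = bezierDeriv T ξ j τ := by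
    intro j τ
    rw [bezierDeriv, derivCtrl, smul_dotProduct, ← Matrix.dotProduct_mulVec, smul_eq_mul,
      dotProduct, Finset.mul_sum]
    exact Finset.sum_congr rfl fun i _ => by ring
  split_ifs with h
  · rw [← key]
    simp [Matrix.vecMul, dotProduct, bezierD, h]
  · rw [← key]
    simp [Matrix.vecMul, dotProduct, bezierD, h]

/-- Uniqueness in Hermite interpolation. A coefficient vector in the kernel gives a polynomial of
degree at most `2n - 1` with zeros of order `n` at both `0` and `1`. It is divisible by `Xⁿ(X -
1)ⁿ`, of degree `2n`, hence zero. -/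
theorem isUnit_bezierD {n : ℕ} (hn : 0 < n) {T : ℝ} (hT : 0 < T) : IsUnit (bezierD n T) := by
  rw [← Matrix.vecMul_injective_iff_isUnit]
  have hlin : ∀ ξ : Fin (2 * n) → ℝ, Matrix.vecMul ξ (bezierD n T) = 0 → ξ = 0 := by
    intro ξ hξ
    apply bernSum_injective
    by_contra hp
    have hd : ∀ j < n, (derivative^[j] (bernSum ξ)).IsRoot 0 ∧
        (derivative^[j] (bernSum ξ)).IsRoot 1 := by
      intro j hj
      have hTj : (1 / T ^ j) ≠ 0 := by positivity
      have h0 := congrFun hξ ⟨j, by omega⟩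
      have h1 := congrFun hξ ⟨n + j, by omega⟩
      rw [vecMul_bezierD] at h0 h1
      rw [if_pos hj, bezierDeriv_eq hn, zero_div] at h0
      rw [if_neg (by simp), Nat.add_sub_cancel_left, bezierDeriv_eq hn, div_self hT.ne'] at h1
      exact ⟨(mul_eq_zero.1 h0).resolve_left hTj, (mul_eq_zero.1 h1).resolve_left hTj⟩
    have r0 : n ≤ (bernSum ξ).rootMultiplicity 0 := by
      have := lt_rootMultiplicity_of_isRoot_iterate_derivative (n := n - 1) hp
        fun j hj => (hd j (by omega)).1
      omega
    have r1 : n ≤ (bernSum ξ).rootMultiplicity 1 := by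
      have := lt_rootMultiplicity_of_isRoot_iterate_derivative (n := n - 1) hp
        fun j hj => (hd j (by omega)).2
      omega
    rw [le_rootMultiplicity_iff hp] at r0 r1
    have hc : IsCoprime ((X - C 0 : ℝ[X]) ^ n) ((X - C 1) ^ n) :=
      (isCoprime_X_sub_C_of_isUnit_sub (by simp)).pow
    have := natDegree_le_of_dvd (hc.mul_dvd r0 r1) hp
    rw [natDegree_mul (pow_ne_zero _ (X_sub_C_ne_zero _)) (pow_ne_zero _ (X_sub_C_ne_zero _)),
      natDegree_pow, natDegree_pow, natDegree_X_sub_C, natDegree_X_sub_C] at this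
    have := natDegree_bernSum_le ξ
    omega
  intro ξ ξ' h
  have h' : Matrix.vecMul (ξ - ξ') (bezierD n T) = 0 := by
    rw [Matrix.sub_vecMul]
    exact sub_eq_zero.2 h
  exact sub_eq_zero.1 (hlin _ h')

theorem vecMul_ctrl {n : ℕ} (hn : 0 < n) {T : ℝ} (hT : 0 < T) (x₀ x₁ : State n) :
    Matrix.vecMul (ctrl T x₀ x₁) (bezierD n T) = joinStates x₀ x₁ := by
  rw [ctrl, Matrix.vecMul_vecMul, Matrix.nonsing_inv_mul _
    ((Matrix.isUnit_iff_isUnit_det _).1 (isUnit_bezierD hn hT)), Matrix.vecMul_one]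

/-- The curve `(r, r', …, r⁽ⁿ⁻¹⁾)` for the Bézier curve `r` with control points `ξ`. -/
noncomputable def bezierState {n : ℕ} (T : ℝ) (ξ : Fin (2 * n) → ℝ) (τ : ℝ) : State n :=
  WithLp.toLp 2 fun j : Fin n => bezierDeriv T ξ j.val τ

theorem bezierState_ctrl_zero {n : ℕ} (hn : 0 < n) {T : ℝ} (hT : 0 < T) (x₀ x₁ : State n) :
    bezierState T (ctrl T x₀ x₁) 0 = x₀ := by
  ext j
  have hj := j.isLt
  have h := congrFun (vecMul_ctrl hn hT x₀ x₁) ⟨j, by omega⟩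
  rw [vecMul_bezierD, if_pos hj] at h
  simpa [bezierState, joinStates] using h

theorem bezierState_ctrl_end {n : ℕ} (hn : 0 < n) {T : ℝ} (hT : 0 < T) (x₀ x₁ : State n) :
    bezierState T (ctrl T x₀ x₁) T = x₁ := by
  ext j
  have hj := j.isLt
  have h := congrFun (vecMul_ctrl hn hT x₀ x₁) ⟨n + j, by omega⟩
  rw [vecMul_bezierD, if_neg (by simp)] at h
  simpa [bezierState, joinStates] using h

theorem hasDerivAt_bezierState {n : ℕ} (hn : 0 < n) (T : ℝ) (ξ : Fin (2 * n) → ℝ) (τ : ℝ) :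
    HasDerivAt (bezierState T ξ) (chain (bezierState T ξ τ) (bezierDeriv T ξ n τ)) τ := by
  have h1 : HasDerivAt (fun τ => fun j : Fin n => bezierDeriv T ξ j.val τ)
      (fun j : Fin n => bezierDeriv T ξ (j.val + 1) τ) τ :=
    hasDerivAt_pi.2 fun j => hasDerivAt_bezierDeriv hn T ξ j τ
  have h2 := (PiLp.continuousLinearEquiv 2 ℝ (fun _ : Fin n => ℝ)).symm.hasFDerivAt.comp_hasDerivAt
    τ h1
  refine h2.congr_deriv ?_
  ext j
  have hj := j.isLt
  by_cases h : j.val + 1 < n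
  · simp [chain, bezierState, h]
  · have : j.val + 1 = n := by omega
    simp [chain, this]

theorem bernsteinVec_nonneg {n : ℕ} {T τ : ℝ} (hT : 0 < T) (hτ : τ ∈ Icc 0 T)
    (i : Fin (2 * n)) : 0 ≤ bernsteinVec n T τ i := by
  have h1 : 0 ≤ τ / T := div_nonneg hτ.1 hT.le
  have h2 : 0 ≤ 1 - τ / T := sub_nonneg.2 ((div_le_one hT).2 hτ.2)
  unfold bernsteinVec
  positivity

theorem sum_bernsteinVec {n : ℕ} (hn : 0 < n) (T τ : ℝ) : ∑ i, bernsteinVec n T τ i = 1 := by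
  have h := congrArg (Polynomial.eval (τ / T)) (bernsteinPolynomial.sum ℝ (2 * n - 1))
  have e : 2 * n - 1 + 1 = 2 * n := by omega
  rw [e, eval_finsetSum, eval_one] at h
  simp only [bernsteinVec_eq, bern]
  rw [Fin.sum_univ_eq_sum_range (fun i => (bernsteinPolynomial ℝ (2 * n - 1) i).eval (τ / T)), h]

/-- The Bernstein weights are nonnegative with sum one on `[0, T]`, so this is a convex combination
there. It carries convex constraints from control points to the whole curve. -/
theorem bezierState_eq_sum {n : ℕ} (T : ℝ) (ξ : Fin (2 * n) → ℝ) (τ : ℝ) :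
    bezierState T ξ τ = ∑ i, bernsteinVec n T τ i • zeta T ξ i := by
  ext j
  simp [bezierState, zeta, bezierDeriv, dotProduct, mul_comm]

theorem bezierState_mem {n : ℕ} (hn : 0 < n) {T : ℝ} (hT : 0 < T) {ξ : Fin (2 * n) → ℝ}
    {C : Set (State n)} (hC : Convex ℝ C) (h : ∀ i, zeta T ξ i ∈ C) {τ : ℝ} (hτ : τ ∈ Icc 0 T) :
    bezierState T ξ τ ∈ C := by
  rw [bezierState_eq_sum]
  exact hC.sum_mem (fun i _ => bernsteinVec_nonneg hT hτ i) (sum_bernsteinVec hn T τ)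
    fun i _ => h i

theorem bezierDeriv_mem {n : ℕ} (hn : 0 < n) {T : ℝ} (hT : 0 < T) {ξ : Fin (2 * n) → ℝ}
    {C : Set ℝ} (hC : Convex ℝ C) (j : ℕ) (h : ∀ i, derivCtrl T ξ j i ∈ C) {τ : ℝ}
    (hτ : τ ∈ Icc 0 T) : bezierDeriv T ξ j τ ∈ C := by
  have : bezierDeriv T ξ j τ = ∑ i, bernsteinVec n T τ i • derivCtrl T ξ j i := by
    simp [bezierDeriv, dotProduct, mul_comm]
  rw [this]
  exact hC.sum_mem (fun i _ => bernsteinVec_nonneg hT hτ i) (sum_bernsteinVec hn T τ)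
    fun i _ => h i

theorem ctrl_zero {n : ℕ} (T : ℝ) : ctrl T (0 : State n) 0 = 0 := by
  have : joinStates (0 : State n) 0 = 0 := by
    funext c
    simp [joinStates]
  rw [ctrl, this, Matrix.zero_vecMul]

theorem derivCtrl_zero {n : ℕ} (T : ℝ) (j : ℕ) : derivCtrl T (0 : Fin (2 * n) → ℝ) j = 0 := by
  simp [derivCtrl]

theorem zeta_zero {n : ℕ} (T : ℝ) (i : Fin (2 * n)) : zeta T (0 : Fin (2 * n) → ℝ) i = 0 := by
  ext j
  simp [zeta, derivCtrl_zero]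

end Bezier

section

/-! ### The quadratic program of the low-level controller -/

/-! ### Linearity of the integrator chain -/

section chain

variable {n : ℕ}

theorem chain_add (x y : State n) (a b : ℝ) : chain (x + y) (a + b) = chain x a + chain y b := by
  ext j
  by_cases h : j.val + 1 < n <;> simp [chain, h]

theorem chain_smul (c : ℝ) (x : State n) (a : ℝ) : chain (c • x) (c * a) = c • chain x a := by
  ext j
  by_cases h : j.val + 1 < n <;> simp [chain, h]

theorem chain_sub (x y : State n) (a b : ℝ) : chain (x - y) (a - b) = chain x a - chain y b := by
  ext j
  by_cases h : j.val + 1 < n <;> simp [chain, h]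

theorem chain_zero_smul (a : ℝ) : chain (0 : State n) a = a • chain 0 1 := by
  rw [← chain_smul, smul_zero, mul_one]

theorem chain_eq (x : State n) (a : ℝ) : chain x a = chain x 0 + a • chain 0 1 := by
  rw [← chain_zero_smul, ← chain_add, add_zero, zero_add]

/-- `chain` as a continuous linear map. -/
noncomputable def chainCLM (n : ℕ) : State n × ℝ →L[ℝ] State n :=
  LinearMap.toContinuousLinearMap
    { toFun := fun p => chain p.1 p.2
      map_add' := fun p q => chain_add p.1 q.1 p.2 q.2
      map_smul' := fun c p => chain_smul c p.1 p.2 }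

end chain

variable {n q : ℕ}

theorem Design.toLp_F_mulVec (D : Design n) (e : State n) :
    (WithLp.toLp 2 (D.F.mulVec e.ofLp) : State n) = chain e (- inner ℝ D.K e) := by
  ext i
  by_cases h : i.val + 1 < n
  · simp only [chain, h, dif_pos, Matrix.mulVec, dotProduct, Design.F, Matrix.of_apply, if_true]
    rw [Finset.sum_eq_single (⟨i.val + 1, h⟩ : Fin n)]
    · simp
    · intro b _ hb
      have : b.val ≠ i.val + 1 := fun h' => hb (Fin.ext h')
      simp [this]
    · simp
  · simp [chain, h, Matrix.mulVec, dotProduct, Design.F, PiLp.inner_apply, mul_comm]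

/-- The Lyapunov equation, read as the decay rate of `V` under the linear feedback `-Kᵀe`. -/
theorem Design.Valid.bform_chain {S : Plant n q} {D : Design n} (hD : D.Valid S) (e : State n) :
    2 * bform D.P e (chain e (- inner ℝ D.K e)) = - bform D.Q e e := by
  have h1 : bform (D.F.transpose * D.P + D.P * D.F) e e = - bform D.Q e e := by
    rw [hD.lyapunov]
    simp [bform, Matrix.neg_mulVec]
  have h2 : bform (D.P * D.F) e e = bform D.P e (chain e (- inner ℝ D.K e)) := by
    rw [← D.toLp_F_mulVec]
    simp [bform]
  have h3 : bform (D.F.transpose * D.P) e e = bform D.P e (chain e (- inner ℝ D.K e)) := by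
    rw [← h2, ← bform_transpose, Matrix.transpose_mul]
    congr 2
    simpa using hD.P_posDef.1.eq
  have h4 : bform (D.F.transpose * D.P + D.P * D.F) e e =
      bform (D.F.transpose * D.P) e e + bform (D.P * D.F) e e := by
    simp [bform, Matrix.add_mulVec, dotProduct_add]
  rw [← h1, h4, h2, h3]
  ring

/-- The amount by which the constraint of the quadratic program is violated when the feed-forward
input is applied. -/
noncomputable def Design.excess (D : Design n) (e : State n) : ℝ :=
  2 * bform D.P e (chain 0 1) * inner ℝ D.K e - (bform D.Q e e - lambdaMin D.Q * ‖e‖ ^ 2)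

/-- The feedback correction, in error coordinates, that the quadratic program adds to the
feed-forward input. -/
noncomputable def Design.psi (D : Design n) (e : State n) : ℝ :=
  max (D.excess e) 0 / (2 * bform D.P e (chain 0 1))

/-- In the residual `r = f(x) - v + u g(x)` the constraint is a half-line whose data depend on the
error alone. Comparing with the feedback `-Kᵀe` produces `Design.excess`. -/
theorem mem_clfConstraint_iff {S : Plant n q} {D : Design n} (hD : D.Valid S) (x y : State n)
    (v u : ℝ) : u ∈ clfConstraint S D x y v ↔
      2 * bform D.P (x - y) (chain 0 1) * (S.f x - v + u * S.g x) + D.excess (x - y) ≤ 0 := by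
  have h1 : chain (x - y) (S.f x - v) + u • S.inputField x =
      chain (x - y) (- inner ℝ D.K (x - y)) +
        (inner ℝ D.K (x - y) + (S.f x - v + u * S.g x)) • chain 0 1 := by
    rw [Plant.inputField, chain_eq (x - y) (S.f x - v), chain_eq (x - y) (- _),
      chain_zero_smul (S.g x)]
    module
  have h2 : u ∈ clfConstraint S D x y v ↔
      2 * bform D.P (x - y) (chain (x - y) (S.f x - v) + u • S.inputField x)
        ≤ - lambdaMin D.Q * ‖x - y‖ ^ 2 := Iff.rfl
  have h3 := hD.bform_chain (x - y)
  rw [h2, h1, bform_add_right, bform_smul_right, mul_add, h3, Design.excess]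
  constructor <;> intro h <;> linarith

theorem Design.Valid.excess_le {S : Plant n q} {D : Design n} (hD : D.Valid S) (e : State n) :
    D.excess e ≤ 2 * bform D.P e (chain 0 1) * inner ℝ D.K e := by
  have := lambdaMin_mul_le_bform hD.Q_posDef.1 e
  rw [Design.excess]
  linarith

/-- When the denominator vanishes, the excess is nonpositive because `eᵀQe ≥ λ_min(Q)‖e‖²`. The
constraint is then void, and the convention `a / 0 = 0` gives the right correction. -/
theorem Design.Valid.two_mul_psi {S : Plant n q} {D : Design n} (hD : D.Valid S) (e : State n) :
    2 * bform D.P e (chain 0 1) * D.psi e = max (D.excess e) 0 := by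
  by_cases h : 2 * bform D.P e (chain 0 1) = 0
  · have := hD.excess_le e
    rw [h, zero_mul] at this
    rw [h, zero_mul, max_eq_right this]
  · rw [Design.psi, mul_div_cancel₀ _ h]

/-- The linear feedback `-Kᵀe` is itself admissible, and the least correction is no larger. -/
theorem Design.Valid.abs_psi_le {S : Plant n q} {D : Design n} (hD : D.Valid S) (e : State n) :
    |D.psi e| ≤ ‖D.K‖ * ‖e‖ := by
  refine le_trans ?_ (abs_real_inner_le_norm D.K e)
  by_cases h : 2 * bform D.P e (chain 0 1) = 0
  · rw [Design.psi, h, div_zero, abs_zero]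
    exact abs_nonneg _
  · rw [Design.psi, abs_div, div_le_iff₀ (abs_pos.2 h), ← abs_mul, abs_of_nonneg (le_max_right _ _)]
    refine max_le ((hD.excess_le e).trans ?_) (abs_nonneg _)
    rw [mul_comm]
    exact le_abs_self _

/-- The excess is quadratic in the error and the denominator is linear. -/
theorem Design.psi_smul (D : Design n) {c : ℝ} (hc : 0 < c) (e : State n) :
    D.psi (c • e) = c * D.psi e := by
  have h : D.excess (c • e) = c ^ 2 * D.excess e := by
    simp only [Design.excess, bform_smul_left, bform_smul_right, inner_smul_right, norm_smul,
      mul_pow, Real.norm_eq_abs, sq_abs]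
    ring
  have hmax : max (c ^ 2 * D.excess e) 0 = c ^ 2 * max (D.excess e) 0 := by
    rw [mul_max_of_nonneg _ _ (sq_nonneg c), mul_zero]
  rw [Design.psi, Design.psi, h, hmax, bform_smul_left]
  by_cases hp : bform D.P e (chain 0 1) = 0
  · simp [hp]
  · field_simp

/-- The point `-s` is the unique element of smallest modulus in the half-line of all `r` with `2pr +
d ≤ 0`: it is `0` if that is admissible and the end point otherwise. -/
theorem abs_le_of_halfspace {p d r s : ℝ} (hs : 2 * p * s = max d 0) (hs0 : p = 0 → s = 0)
    (hr : 2 * p * r + d ≤ 0) : s ^ 2 ≤ r ^ 2 ∧ (s ^ 2 = r ^ 2 → r = - s) := by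
  rcases le_or_gt d 0 with hd | hd
  · rw [max_eq_right hd] at hs
    have hs' : s = 0 := by
      by_contra h
      rcases mul_eq_zero.1 hs with h' | h'
      · exact h (hs0 (by linarith))
      · exact h h'
    subst hs'
    refine ⟨by simpa using sq_nonneg r, fun h => ?_⟩
    have : r = 0 := by nlinarith
    rw [this, neg_zero]
  · rw [max_eq_left hd.le] at hs
    have hps : 0 < p * s := by linarith
    have h1 : p * r ≤ - (p * s) := by linarith
    have hp : p ≠ 0 := by
      rintro rfl
      simp at hps
    have hp2 : 0 < p ^ 2 := by positivity
    have h2 : (p * s) ^ 2 ≤ (p * r) ^ 2 := by nlinarith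
    refine ⟨?_, fun h => ?_⟩
    · rw [mul_pow, mul_pow] at h2
      exact le_of_mul_le_mul_left h2 hp2
    · have h3 : (p * s) ^ 2 = (p * r) ^ 2 := by rw [mul_pow, mul_pow, h]
      have h4 : p * r = p * (-s) := by nlinarith
      exact mul_left_cancel₀ hp h4

/-- The solution of the quadratic program. -/
theorem isCLFInput_iff {S : Plant n q} {D : Design n} (hS : S.Valid) (hD : D.Valid S)
    (x y : State n) (v u : ℝ) :
    IsCLFInput S D x y v u ↔ u = (S.g x)⁻¹ * (v - S.f x - D.psi (x - y)) := by
  have hg := hS.g_ne_zero x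
  -- The cost is a fixed positive multiple of the squared residual, so minimizing it means
  -- minimizing `|r|`.
  have hdist : ∀ u', (1 / 2) * ‖u' - feedforward S x v‖ ^ 2 =
      (1 / 2) * (S.g x)⁻¹ ^ 2 * (S.f x - v + u' * S.g x) ^ 2 := by
    intro u'
    rw [Real.norm_eq_abs, sq_abs, feedforward]
    field_simp
    ring
  have hc : 0 < (1 / 2) * (S.g x)⁻¹ ^ 2 := by positivity
  have hs := hD.two_mul_psi (x - y)
  have hs0 : bform D.P (x - y) (chain 0 1) = 0 → D.psi (x - y) = 0 := by
    intro h
    rw [Design.psi, h, mul_zero, div_zero]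
  have hr0 : ∀ u', S.f x - v + u' * S.g x = - D.psi (x - y) ↔
      u' = (S.g x)⁻¹ * (v - S.f x - D.psi (x - y)) := by
    intro u'
    rw [eq_inv_mul_iff_mul_eq₀ hg]
    constructor <;> intro h <;> linarith
  have hfeas : ∀ u', S.f x - v + u' * S.g x = - D.psi (x - y) → u' ∈ clfConstraint S D x y v := by
    intro u' h
    rw [mem_clfConstraint_iff hD, h, mul_neg, hs]
    linarith [le_max_left (D.excess (x - y)) 0]
  rw [← hr0]
  constructor
  · rintro ⟨h1, h2⟩
    have h3 := h2 _ (hfeas _ ((hr0 _).2 rfl))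
    rw [hdist, hdist, (hr0 _).2 rfl, neg_sq] at h3
    rw [mem_clfConstraint_iff hD] at h1
    obtain ⟨h4, h5⟩ := abs_le_of_halfspace hs hs0 h1
    exact h5 (le_antisymm h4 (le_of_mul_le_mul_left h3 hc))
  · intro h
    refine ⟨hfeas u h, fun u' hu' => ?_⟩
    rw [mem_clfConstraint_iff hD] at hu'
    rw [hdist, hdist, h, neg_sq]
    exact mul_le_mul_of_nonneg_left (abs_le_of_halfspace hs hs0 hu').1 hc.le

theorem existsUnique_isCLFInput {S : Plant n q} {D : Design n} (hS : S.Valid) (hD : D.Valid S)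
    (x y : State n) (v : ℝ) : ∃! u, IsCLFInput S D x y v u :=
  ⟨_, (isCLFInput_iff hS hD x y v _).2 rfl, fun _ h => (isCLFInput_iff hS hD x y v _).1 h⟩

theorem clfInput_eq {S : Plant n q} {D : Design n} (hS : S.Valid) (hD : D.Valid S)
    (x y : State n) (v : ℝ) :
    clfInput S D x y v = (S.g x)⁻¹ * (v - S.f x - D.psi (x - y)) :=
  (isCLFInput_iff hS hD x y v _).1
    (Classical.epsilon_spec (existsUnique_isCLFInput hS hD x y v).exists)

/-- Under the low-level controller, the feedback cancels the nonlinearity. -/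
theorem drift_add_clfInput {S : Plant n q} {D : Design n} (hS : S.Valid) (hD : D.Valid S)
    (x y : State n) (v : ℝ) :
    S.drift x + clfInput S D x y v • S.inputField x = chain x (v - D.psi (x - y)) := by
  rw [clfInput_eq hS hD, Plant.drift, Plant.inputField, ← chain_smul, ← chain_add, smul_zero,
    add_zero]
  congr 1
  have := hS.g_ne_zero x
  field_simp
  ring

/-- This is the admissibility of `r = -ψ(e)` in the quadratic program, in error coordinates. -/
theorem Design.Valid.bform_chain_psi_le {S : Plant n q} {D : Design n} (hD : D.Valid S)
    (e : State n) : 2 * bform D.P e (chain e (- D.psi e)) ≤ - lambdaMin D.Q * ‖e‖ ^ 2 := by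
  have h1 : chain e (- D.psi e) = chain e (- inner ℝ D.K e) +
      (inner ℝ D.K e - D.psi e) • chain 0 1 := by
    rw [chain_eq e (- D.psi e), chain_eq e (- inner ℝ D.K e)]
    module
  have h2 := hD.bform_chain e
  have h3 := hD.two_mul_psi e
  have h4 : D.excess e = 2 * bform D.P e (chain 0 1) * inner ℝ D.K e -
    (bform D.Q e e - lambdaMin D.Q * ‖e‖ ^ 2) := rfl
  have h5 := le_max_left (D.excess e) 0
  rw [h1, bform_add_right, bform_smul_right]
  linarith

theorem abs_clfInput_le {S : Plant n q} {D : Design n} (hS : S.Valid) (hD : D.Valid S)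
    (x y : State n) (v : ℝ) :
    |clfInput S D x y v| ≤ |(S.g x)⁻¹| * (|S.f x - v| + ‖D.K‖ * ‖x - y‖) := by
  rw [clfInput_eq hS hD, abs_mul]
  refine mul_le_mul_of_nonneg_left ?_ (abs_nonneg _)
  refine (abs_sub _ _).trans ?_
  rw [abs_sub_comm v]
  exact add_le_add_right (hD.abs_psi_le _) _

end

/-! ### Differential inequalities and differential equations -/

/-- A continuous function, differentiable off a countable set, does not exceed a level `c` if its
derivative is almost everywhere nonpositive above this level. -/
theorem le_of_ae_deriv_nonpos {V : ℝ → ℝ} {a b c : ℝ} (hV : ContinuousOn V (Icc a b))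
    (hVa : V a ≤ c) {Z : Set ℝ} (hZ : Z.Countable)
    (hd : ∀ t ∈ Ioo a b \ Z, DifferentiableAt ℝ V t)
    (hi : IntegrableOn (deriv V) (Ioc a b))
    (hneg : ∀ᵐ t ∂(volume.restrict (Ioo a b)), c < V t → deriv V t ≤ 0) :
    ∀ t ∈ Icc a b, V t ≤ c := by
  intro t₁ ht₁
  by_contra! hlt
  have hsub : Icc a t₁ ⊆ Icc a b := Icc_subset_Icc_right ht₁.2
  have hcomp : IsCompact (Icc a t₁ ∩ V ⁻¹' Iic c) :=
    isCompact_Icc.of_isClosed_subset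
      ((hV.mono hsub).preimage_isClosed_of_isClosed isClosed_Icc isClosed_Iic) inter_subset_left
  -- Take the last time `s` before `t₁` at which `V ≤ c`. After it `V` exceeds `c`, so its
  -- derivative is a.e. nonpositive, and integrating contradicts `V t₁ > c`.
  obtain ⟨s, ⟨hs, hVs⟩, hmax⟩ :=
    hcomp.exists_isGreatest ⟨a, left_mem_Icc.2 ht₁.1, hVa⟩
  have hst : s ≤ t₁ := hs.2
  have habove : ∀ t ∈ Ioc s t₁, c < V t := by
    intro t ht
    by_contra! h
    exact absurd (hmax ⟨⟨hs.1.trans ht.1.le, ht.2⟩, h⟩) (not_le.2 ht.1)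
  have hint : ∫ t in s..t₁, deriv V t = V t₁ - V s := by
    refine integral_eq_of_hasDerivAt_off_countable_of_le V (deriv V) hst hZ
      (hV.mono (Icc_subset_Icc hs.1 ht₁.2)) (fun t ht => ?_) ?_
    · exact (hd t ⟨⟨hs.1.trans_lt ht.1.1, ht.1.2.trans_le ht₁.2⟩, ht.2⟩).hasDerivAt
    · rw [intervalIntegrable_iff_integrableOn_Ioc_of_le hst]
      exact hi.mono_set (Ioc_subset_Ioc hs.1 ht₁.2)
  have hle : ∫ t in s..t₁, deriv V t ≤ 0 := by
    rw [intervalIntegral.integral_of_le hst, integral_Ioc_eq_integral_Ioo]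
    refine setIntegral_nonpos_of_ae_restrict ?_
    have h1 := ae_restrict_of_ae_restrict_of_subset (Ioo_subset_Ioo hs.1 ht₁.2) hneg
    filter_upwards [h1, ae_restrict_mem measurableSet_Ioo] with t h2 h3
    exact h2 (habove t ⟨h3.1, h3.2.le⟩)
  have : V s ≤ c := hVs
  linarith

/-- One-sided limits bound the derivative near each point, and compactness makes the bound uniform.
-/
theorem PiecewiseC1.exists_norm_deriv_le {n : ℕ} {φ : ℝ → State n} {b : ℝ}
    (h : PiecewiseC1 φ b) : ∃ C, ∀ t ∈ Icc 0 b, ‖deriv φ t‖ ≤ C := by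
  obtain ⟨-, -, hr, hl⟩ := h
  have hside : ∀ (l : Filter ℝ), (∃ y, Tendsto (deriv φ) l (𝓝 y)) →
      ∃ C, ∀ᶠ t in l, ‖deriv φ t‖ ≤ C := by
    rintro l ⟨y, hy⟩
    exact ⟨‖y‖ + 1, (hy.norm.eventually (gt_mem_nhds (lt_add_one _))).mono fun _ h => h.le⟩
  refine isCompact_Icc.induction_on (p := fun s => ∃ C, ∀ t ∈ s, ‖deriv φ t‖ ≤ C)
    ⟨0, by simp⟩ ?_ ?_ ?_
  · rintro s t hst ⟨C, hC⟩
    exact ⟨C, fun τ hτ => hC τ (hst hτ)⟩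
  · rintro s t ⟨C, hC⟩ ⟨C', hC'⟩
    refine ⟨max C C', fun τ hτ => ?_⟩
    rcases hτ with hτ | hτ
    · exact (hC τ hτ).trans (le_max_left _ _)
    · exact (hC' τ hτ).trans (le_max_right _ _)
  · intro t ht
    have hR : ∃ C, ∀ᶠ τ in 𝓝[Icc 0 b ∩ Ioi t] t, ‖deriv φ τ‖ ≤ C := by
      rcases lt_or_eq_of_le ht.2 with h' | h'
      · obtain ⟨C, hC⟩ := hside _ (hr t ⟨ht.1, h'⟩)
        exact ⟨C, hC.filter_mono (nhdsWithin_mono _ inter_subset_right)⟩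
      · refine ⟨0, ?_⟩
        have : Icc 0 b ∩ Ioi t = ∅ := by
          ext τ
          simp only [mem_inter_iff, mem_Icc, mem_Ioi, mem_empty_iff_false, iff_false]
          intro h
          linarith [h.1.2, h.2]
        rw [this, nhdsWithin_empty]
        exact eventually_bot
    have hL : ∃ C, ∀ᶠ τ in 𝓝[Icc 0 b ∩ Iio t] t, ‖deriv φ τ‖ ≤ C := by
      rcases lt_or_eq_of_le ht.1 with h' | h'
      · obtain ⟨C, hC⟩ := hside _ (hl t ⟨h', ht.2⟩)
        exact ⟨C, hC.filter_mono (nhdsWithin_mono _ inter_subset_right)⟩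
      · refine ⟨0, ?_⟩
        have : Icc 0 b ∩ Iio t = ∅ := by
          ext τ
          simp only [mem_inter_iff, mem_Icc, mem_Iio, mem_empty_iff_false, iff_false]
          intro h
          linarith [h.1.1, h.2]
        rw [this, nhdsWithin_empty]
        exact eventually_bot
    obtain ⟨C, hC⟩ := hR
    obtain ⟨C', hC'⟩ := hL
    -- The last entry of the maximum handles `t` itself, about which the one-sided limits say
    -- nothing.
    refine ⟨{τ | ‖deriv φ τ‖ ≤ max (max C C') ‖deriv φ t‖}, ?_, max (max C C') ‖deriv φ t‖,
      fun τ hτ => hτ⟩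
    have hcover : Icc 0 b ⊆ (Icc 0 b ∩ Ioi t) ∪ (Icc 0 b ∩ Iio t) ∪ {t} := by
      intro τ hτ
      rcases lt_trichotomy τ t with h' | h' | h'
      · exact Or.inl (Or.inr ⟨hτ, h'⟩)
      · exact Or.inr h'
      · exact Or.inl (Or.inl ⟨hτ, h'⟩)
    refine nhdsWithin_mono _ hcover ?_
    rw [nhdsWithin_union, nhdsWithin_union, nhdsWithin_singleton]
    refine mem_sup.2 ⟨mem_sup.2 ⟨?_, ?_⟩, ?_⟩
    · exact hC.mono fun τ h => h.trans ((le_max_left _ _).trans (le_max_left _ _))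
    · exact hC'.mono fun τ h => h.trans ((le_max_right _ _).trans (le_max_left _ _))
    · exact mem_pure.2 (le_max_right (max C C') _)

/-! ### Global solvability of Lipschitz equations -/

section ODE

variable {E : Type*} [NormedAddCommGroup E] [NormedSpace ℝ E]

theorem exists_solution_short [CompleteSpace E] {F : ℝ → E → E} {K : ℝ≥0} (hK : ∀ t, LipschitzWith K (F t))
    (hc : ∀ x, Continuous (F · x)) {h : ℝ≥0} (hh : K * h ≤ 1 / 2) (t₀ : ℝ) (x₀ : E) :
    ∃ z : ℝ → E, z t₀ = x₀ ∧
      ∀ t ∈ Icc t₀ (t₀ + h), HasDerivWithinAt z (F t (z t)) (Icc t₀ (t₀ + h)) t := by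
  obtain ⟨M', hM'⟩ := (isCompact_Icc (a := t₀) (b := t₀ + h)).exists_bound_of_continuousOn
    (hc x₀).continuousOn
  set M : ℝ≥0 := M'.toNNReal
  have hM : ∀ t ∈ Icc t₀ (t₀ + h), ‖F t x₀‖ ≤ M := fun t ht =>
    (hM' t ht).trans (Real.le_coe_toNNReal _)
  have hle : t₀ ≤ t₀ + h := by simp
  -- With radius `2Mh` the field is bounded by `M + 2KMh ≤ 2M`, so solutions stay in the ball for
  -- time `h`. The condition on `h` does not involve the initial data, so steps of equal length can
  -- be iterated.
  have hpl : IsPicardLindelof F (⟨t₀, left_mem_Icc.2 hle⟩ : Icc t₀ (t₀ + h)) x₀ (2 * M * h) 0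
      (M + K * (2 * M * h)) K := by
    refine ⟨fun t _ => (hK t).lipschitzOnWith, fun x _ => (hc x).continuousOn,
      fun t ht x hx => ?_, ?_⟩
    · have h1 := (hK t).dist_le_mul x x₀
      have h2 : dist x x₀ ≤ (2 * M * h : ℝ≥0) := hx
      have h3 : ‖F t x‖ ≤ ‖F t x₀‖ + dist (F t x) (F t x₀) := by
        rw [dist_eq_norm]
        exact norm_le_norm_add_norm_sub' _ _
      have h4 : (K : ℝ) * dist x x₀ ≤ K * (2 * M * h : ℝ≥0) :=
        mul_le_mul_of_nonneg_left h2 K.coe_nonneg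
      have h5 := hM t ht
      rw [NNReal.coe_add, NNReal.coe_mul K]
      linarith
    · have h1 : (K : ℝ) * h ≤ 1 / 2 := by exact_mod_cast hh
      have h2 : max (t₀ + h - t₀) (t₀ - t₀) = (h : ℝ) := by
        rw [sub_self, add_sub_cancel_left, max_eq_left h.coe_nonneg]
      have h3 : (K : ℝ) * h * (2 * (M * h)) ≤ 1 / 2 * (2 * (M * h)) :=
        mul_le_mul_of_nonneg_right h1 (by positivity)
      change ((M + K * (2 * M * h) : ℝ≥0) : ℝ) * max (t₀ + h - t₀) (t₀ - t₀) ≤ _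
      rw [h2]
      push_cast
      linarith
  exact hpl.exists_eq_forall_mem_Icc_hasDerivWithinAt₀

/-- Both pieces solve the same equation, so their one-sided derivatives agree at `t₁`. Outside the
closure of an interval the derivative within it is unconstrained, so the two conditions can be
joined over the union. -/
theorem exists_solution_glue {F : ℝ → E → E} {t₀ t₁ t₂ : ℝ} (h₁ : t₀ ≤ t₁) (h₂ : t₁ ≤ t₂)
    {z₁ z₂ : ℝ → E} (hz : z₂ t₁ = z₁ t₁)
    (hz₁ : ∀ t ∈ Icc t₀ t₁, HasDerivWithinAt z₁ (F t (z₁ t)) (Icc t₀ t₁) t)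
    (hz₂ : ∀ t ∈ Icc t₁ t₂, HasDerivWithinAt z₂ (F t (z₂ t)) (Icc t₁ t₂) t) :
    ∃ z : ℝ → E, z t₀ = z₁ t₀ ∧
      ∀ t ∈ Icc t₀ t₂, HasDerivWithinAt z (F t (z t)) (Icc t₀ t₂) t := by
  classical
  let z : ℝ → E := fun t => if t ≤ t₁ then z₁ t else z₂ t
  have e₁ : ∀ t ∈ Icc t₀ t₁, z t = z₁ t := fun t ht => if_pos ht.2
  have e₂ : ∀ t ∈ Icc t₁ t₂, z t = z₂ t := by
    intro t ht
    rcases eq_or_lt_of_le ht.1 with rfl | h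
    · simp [z, hz]
    · exact if_neg (not_le.2 h)
  refine ⟨z, e₁ t₀ (left_mem_Icc.2 h₁), fun t ht => ?_⟩
  rw [← Icc_union_Icc_eq_Icc h₁ h₂]
  have d₁ : HasDerivWithinAt z (F t (z t)) (Icc t₀ t₁) t := by
    by_cases h : t ∈ Icc t₀ t₁
    · rw [e₁ t h]
      exact (hz₁ t h).congr e₁ (e₁ t h)
    · exact hasDerivWithinAt_iff_hasFDerivWithinAt.2
        (HasFDerivWithinAt.of_notMem_closure (by rwa [closure_Icc]))
  have d₂ : HasDerivWithinAt z (F t (z t)) (Icc t₁ t₂) t := by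
    by_cases h : t ∈ Icc t₁ t₂
    · rw [e₂ t h]
      exact (hz₂ t h).congr e₂ (e₂ t h)
    · exact hasDerivWithinAt_iff_hasFDerivWithinAt.2
        (HasFDerivWithinAt.of_notMem_closure (by rwa [closure_Icc]))
  exact d₁.union d₂

/-- Solutions of a globally Lipschitz differential equation exist on every bounded interval. -/
theorem exists_solution_Icc [CompleteSpace E] {F : ℝ → E → E} {K : ℝ≥0} (hK : ∀ t, LipschitzWith K (F t))
    (hc : ∀ x, Continuous (F · x)) (t₀ : ℝ) (x₀ : E) {T : ℝ} (hT : 0 ≤ T) :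
    ∃ z : ℝ → E, z t₀ = x₀ ∧
      ∀ t ∈ Icc t₀ (t₀ + T), HasDerivWithinAt z (F t (z t)) (Icc t₀ (t₀ + T)) t := by
  -- Enough equal steps to have `K · T / m ≤ 1 / 2`.
  obtain ⟨m, hm⟩ := exists_nat_gt (2 * (K * T))
  have hm0 : (0 : ℝ) < m := lt_of_le_of_lt (by positivity) hm
  let h : ℝ≥0 := ⟨T / m, by positivity⟩
  have hh : K * h ≤ 1 / 2 := by
    rw [← NNReal.coe_le_coe]
    change (K : ℝ) * (T / m) ≤ _
    rw [← mul_div_assoc, div_le_iff₀ hm0]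
    push_cast
    linarith
  have key : ∀ k : ℕ, ∃ z : ℝ → E, z t₀ = x₀ ∧
      ∀ t ∈ Icc t₀ (t₀ + k * h), HasDerivWithinAt z (F t (z t)) (Icc t₀ (t₀ + k * h)) t := by
    intro k
    induction k with
    | zero =>
      obtain ⟨z, hz, -⟩ := exists_solution_short hK hc hh t₀ x₀
      refine ⟨z, hz, fun t ht => ?_⟩
      have hs : Icc t₀ (t₀ + (0 : ℕ) * h) = {t₀} := by simp
      rw [hs] at ht ⊢
      rw [mem_singleton_iff.1 ht]
      exact hasDerivWithinAt_iff_hasFDerivWithinAt.2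
        (HasFDerivWithinAt.of_subsingleton subsingleton_singleton)
    | succ k ih =>
      obtain ⟨z₁, hz₁, hd₁⟩ := ih
      obtain ⟨z₂, hz₂, hd₂⟩ := exists_solution_short hK hc hh (t₀ + k * h) (z₁ (t₀ + k * h))
      have h0 : (0 : ℝ) ≤ h := h.coe_nonneg
      obtain ⟨z, hz, hd⟩ := exists_solution_glue (le_add_of_nonneg_right (by positivity))
        (le_add_of_nonneg_right h0) hz₂ hd₁ hd₂
      have e : t₀ + ((k + 1 : ℕ) : ℝ) * h = t₀ + k * h + h := by
        push_cast
        ring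
      rw [e]
      exact ⟨z, hz.trans hz₁, hd⟩
  have e : (m : ℝ) * h = T := mul_div_cancel₀ T hm0.ne'
  have := key m
  rwa [e] at this

end ODE

/-- A bounded piecewise continuous function has a primitive. -/
theorem PiecewiseContinuous.exists_primitive {n : ℕ} {w : ℝ → State n}
    (hw : PiecewiseContinuous w) {C : ℝ} (hC : ∀ t, 0 ≤ t → ‖w t‖ ≤ C) :
    ∃ W : ℝ → State n, Continuous W ∧
      ∀ t, 0 < t → ContinuousAt w t → HasDerivAt W (w t) t := by
  have hcount : {t | 0 < t ∧ ¬ ContinuousAt w t}.Countable := by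
    refine (countable_iUnion fun k : ℕ => (hw.1 k).countable).mono fun t ht => ?_
    obtain ⟨k, hk⟩ := exists_nat_ge t
    exact mem_iUnion.2 ⟨k, ⟨ht.1, hk⟩, ht.2⟩
  have hcont : ContinuousOn w (Ioi 0 \ {t | 0 < t ∧ ¬ ContinuousAt w t}) := by
    intro t ht
    by_contra h
    exact ht.2 ⟨ht.1, fun h' => h h'.continuousWithinAt⟩
  -- Measurability comes from continuity off a countable set. The function is cut off at `0` because
  -- nothing is assumed about it at negative times.
  have hmeas : AEStronglyMeasurable ((Ioi 0).indicator w) volume := by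
    rw [aestronglyMeasurable_indicator_iff measurableSet_Ioi,
      ← Measure.restrict_congr_set (sdiff_null_ae_eq_self (hcount.measure_zero volume))]
    exact hcont.aestronglyMeasurable (measurableSet_Ioi.diff hcount.measurableSet)
  have hbound : ∀ t, ‖(Ioi 0).indicator w t‖ ≤ C := by
    intro t
    by_cases h : t ∈ Ioi (0 : ℝ)
    · rw [indicator_of_mem h]
      exact hC t (le_of_lt h)
    · rw [indicator_of_notMem h, norm_zero]
      exact (norm_nonneg _).trans (hC 0 le_rfl)
  have hint : ∀ a b, IntervalIntegrable ((Ioi 0).indicator w) volume a b := fun a b =>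
    (intervalIntegrable_const (c := C)).mono_fun hmeas.restrict
      (Eventually.of_forall fun t => (hbound t).trans (le_abs_self C))
  refine ⟨fun t => ∫ s in (0 : ℝ)..t, (Ioi 0).indicator w s,
    intervalIntegral.continuous_primitive hint 0, fun t ht hct => ?_⟩
  have heq : (Ioi 0).indicator w =ᶠ[𝓝 t] w :=
    mem_of_superset (Ioi_mem_nhds ht) fun s hs => indicator_of_mem hs w
  have := intervalIntegral.integral_hasDerivAt_right (hint 0 t)
    hmeas.stronglyMeasurableAtFilter (hct.congr heq.symm)
  rwa [indicator_of_mem (mem_Ioi.2 ht)] at this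

section

variable {n q N : ℕ}

/-! ### Invariance of the error ellipsoid -/

theorem hasDerivAt_bform {A : Matrix (Fin n) (Fin n) ℝ} (hA : A.IsHermitian) {e : ℝ → State n}
    {e' : State n} {t : ℝ} (he : HasDerivAt e e' t) :
    HasDerivAt (fun s => bform A (e s) (e s)) (2 * bform A (e t) e') t := by
  have hM : ∀ x y : State n, bform A x y =
      inner ℝ x (LinearMap.toContinuousLinearMap (Matrix.toEuclideanLin A) y) := by
    intro x y
    rw [EuclideanSpace.inner_eq_star_dotProduct, dotProduct_comm]
    simp [bform]
  have h1 := he.inner ℝ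
    ((LinearMap.toContinuousLinearMap (Matrix.toEuclideanLin A)).hasFDerivAt.comp_hasDerivAt t he)
  simp only [Function.comp_def, ← hM] at h1
  refine h1.congr_deriv ?_
  rw [bform_comm hA e']
  ring

theorem Design.mem_E {D : Design n} {v : State n} :
    v ∈ D.E ↔ bform D.P v v ≤ D.γ * D.wbar ^ 2 := Iff.rfl

theorem Design.neg_mem_E {D : Design n} {v : State n} (hv : v ∈ D.E) : -v ∈ D.E := by
  rw [Design.mem_E, bform_neg]
  exact hv

theorem Design.Valid.γ_nonneg {S : Plant n q} {D : Design n} (hn : 0 < n) (hD : D.Valid S) :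
    0 ≤ D.γ := by
  have := lambdaMax_pos hn hD.P_posDef
  unfold Design.γ
  positivity

theorem Design.Valid.zero_mem_E {S : Plant n q} {D : Design n} (hn : 0 < n) (hD : D.Valid S) :
    (0 : State n) ∈ D.E := by
  have h := hD.γ_nonneg hn
  have h0 : bform D.P 0 0 = 0 := by simp [bform]
  rw [Design.mem_E, h0]
  positivity

theorem Design.Valid.norm_le_ebar {S : Plant n q} {D : Design n} (hn : 0 < n) (hD : D.Valid S)
    {v : State n} (hv : v ∈ D.E) : ‖v‖ ≤ D.ebar := by
  refine Real.le_sqrt_of_sq_le ?_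
  rw [le_div_iff₀ (lambdaMin_pos hn hD.P_posDef), mul_comm]
  exact (lambdaMin_mul_le_bform hD.P_posDef.1 v).trans hv

/-- The Lyapunov function decreases outside of the error ellipsoid. -/
theorem Design.Valid.bform_nonpos_of_lt {S : Plant n q} {D : Design n} (hn : 0 < n)
    (hD : D.Valid S) {e w : State n} (hw : ‖w‖ ≤ D.wbar)
    (he : D.γ * D.wbar ^ 2 < bform D.P e e) :
    2 * bform D.P e (chain e (- D.psi e) + w) ≤ 0 := by
  have hP := lambdaMax_pos hn hD.P_posDef
  have hQ := lambdaMin_pos hn hD.Q_posDef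
  have h1 := hD.bform_chain_psi_le e
  have h2 := bform_le_lambdaMax_mul_norm hn hD.P_posDef e w
  have h3 := he.trans_le (bform_le_lambdaMax_mul hD.P_posDef.1 e)
  -- The constant `γ` is made for this: `γ w̄² < V ≤ λ_max(P)‖e‖²` says exactly that the decay
  -- `λ_min(Q)‖e‖` beats the disturbance term `2 λ_max(P) w̄`.
  have h4 : (2 * lambdaMax D.P * D.wbar) ^ 2 < (lambdaMin D.Q * ‖e‖) ^ 2 := by
    have : D.γ * D.wbar ^ 2 =
        lambdaMax D.P * ((2 * lambdaMax D.P * D.wbar) ^ 2 / lambdaMin D.Q ^ 2) := by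
      rw [Design.γ]
      field_simp
      ring
    rw [this] at h3
    have h5 := lt_of_mul_lt_mul_left h3 hP.le
    rw [div_lt_iff₀ (by positivity)] at h5
    rw [mul_pow (lambdaMin D.Q)]
    linarith
  have h5 : 2 * lambdaMax D.P * D.wbar < lambdaMin D.Q * ‖e‖ :=
    lt_of_pow_lt_pow_left₀ 2 (by positivity) h4
  have h6 : lambdaMax D.P * (‖e‖ * ‖w‖) ≤ lambdaMax D.P * (‖e‖ * D.wbar) := by gcongr
  rw [bform_add_right]
  nlinarith [mul_le_mul_of_nonneg_right h5.le (norm_nonneg e)]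

/-- The tracking error stays in the ellipsoid `ℰ`. -/
theorem Design.Valid.sub_mem_E {S : Plant n q} {D : Design n} (hn : 0 < n) (hD : D.Valid S)
    {φ y w : ℝ → State n} {v : ℝ → ℝ} {a b c : ℝ} (ha : 0 ≤ a) (hb : b ≤ c)
    (hφ : PiecewiseC1 φ c) (hy : ∀ t, HasDerivAt y (chain (y t) (v t)) t) (hv : Continuous v)
    (hw : ∀ t, 0 ≤ t → ‖w t‖ ≤ D.wbar)
    (hode : ∀ᵐ t ∂(volume.restrict (Ioo a b)),
      HasDerivAt φ (chain (φ t) (v t - D.psi (φ t - y t)) + w t) t)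
    (hinit : φ a - y a ∈ D.E) : ∀ t ∈ Icc a b, φ t - y t ∈ D.E := by
  have hyc : Continuous y := continuous_iff_continuousAt.2 fun t => (hy t).continuousAt
  have hsub : Icc a b ⊆ Icc 0 c := Icc_subset_Icc ha hb
  have hec : ContinuousOn (fun t => φ t - y t) (Icc a b) := (hφ.1.mono hsub).sub hyc.continuousOn
  have hy'c : Continuous fun t => chain (y t) (v t) :=
    (chainCLM n).continuous.comp (hyc.prodMk hv)
  obtain ⟨Z, hZ, hdiff⟩ := hφ.2.1
  have hdV : ∀ t, DifferentiableAt ℝ φ t →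
      HasDerivAt (fun t => bform D.P (φ t - y t) (φ t - y t))
        (2 * bform D.P (φ t - y t) (deriv φ t - chain (y t) (v t))) t := fun t ht =>
    hasDerivAt_bform hD.P_posDef.1 (ht.hasDerivAt.sub (hy t))
  have hdφ : ∀ t ∈ Ioo a b \ Z, DifferentiableAt ℝ φ t := fun t ht =>
    (hdiff t ⟨⟨ha.trans_lt ht.1.1, ht.1.2.trans_le hb⟩, ht.2⟩).1
  refine le_of_ae_deriv_nonpos (V := fun t => bform D.P (φ t - y t) (φ t - y t))
    (continuous_bform.comp_continuousOn (hec.prodMk hec)) hinit hZ.countable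
    (fun t ht => (hdV t (hdφ t ht)).differentiableAt) ?_ ?_
  -- The derivative of `V` is bounded almost everywhere, hence integrable, as the fundamental
  -- theorem of calculus requires.
  · obtain ⟨C₁, hC₁⟩ := isCompact_Icc.exists_bound_of_continuousOn hec
    obtain ⟨C₂, hC₂⟩ := (isCompact_Icc (a := a) (b := b)).exists_bound_of_continuousOn
      hy'c.continuousOn
    obtain ⟨C₃, hC₃⟩ := hφ.exists_norm_deriv_le
    have hP := (lambdaMax_pos hn hD.P_posDef).le
    refine Measure.integrableOn_of_bounded (M := 2 * (lambdaMax D.P * (C₁ * (C₃ + C₂))))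
      measure_Ioc_lt_top.ne (measurable_deriv _).aestronglyMeasurable ?_
    rw [← Measure.restrict_congr_set Ioo_ae_eq_Ioc]
    have hZ0 : ∀ᵐ t ∂(volume.restrict (Ioo a b)), t ∉ Z :=
      ae_restrict_of_ae (compl_mem_ae_iff.2 (hZ.measure_zero volume))
    filter_upwards [hZ0, ae_restrict_mem measurableSet_Ioo] with t htZ ht
    have ht' : t ∈ Icc a b := Ioo_subset_Icc_self ht
    rw [(hdV t (hdφ t ⟨ht, htZ⟩)).deriv, Real.norm_eq_abs, abs_mul, abs_two]
    refine mul_le_mul_of_nonneg_left ?_ zero_le_two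
    have key : ∀ z : State n, ‖z‖ ≤ C₃ + C₂ →
        bform D.P (φ t - y t) z ≤ lambdaMax D.P * (C₁ * (C₃ + C₂)) := by
      intro z hz
      refine (bform_le_lambdaMax_mul_norm hn hD.P_posDef _ z).trans
        (mul_le_mul_of_nonneg_left ?_ hP)
      exact mul_le_mul (hC₁ t ht') hz (norm_nonneg _) ((norm_nonneg _).trans (hC₁ t ht'))
    have hz : ‖deriv φ t - chain (y t) (v t)‖ ≤ C₃ + C₂ :=
      (norm_sub_le _ _).trans (add_le_add (hC₃ t (hsub ht')) (hC₂ t ht'))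
    refine abs_le'.2 ⟨key _ hz, ?_⟩
    have h1 := key (-(deriv φ t - chain (y t) (v t))) (by rwa [norm_neg])
    rwa [← neg_one_smul ℝ, bform_smul_right, neg_one_mul] at h1
  · filter_upwards [hode, ae_restrict_mem measurableSet_Ioo] with t ht hmem hlt
    rw [(hdV t ht.differentiableAt).deriv, ht.deriv]
    -- Subtracting the reference dynamics removes `v` and leaves the autonomous error equation
    -- driven by `w`.
    have e1 : chain (φ t) (v t - D.psi (φ t - y t)) + w t - chain (y t) (v t) =
        chain (φ t - y t) (- D.psi (φ t - y t)) + w t := by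
      have : - D.psi (φ t - y t) = v t - D.psi (φ t - y t) - v t := by ring
      rw [this, chain_sub]
      abel
    rw [e1]
    exact hD.bform_nonpos_of_lt hn (hw t (ha.trans hmem.1.le)) hlt

/-! ### Consequences of feasibility -/

theorem Plant.convex_X (S : Plant n q) : Convex ℝ S.X := by
  have : S.X = ⋂ j, {x | inner ℝ (S.L j) x ≤ S.l j} := by
    ext x
    simp [Plant.X]
  rw [this]
  exact convex_iInter fun j => convex_halfSpace_le (innerSL ℝ (S.L j)).toLinearMap.isLinear _

theorem convex_pontryaginDiff {A B : Set (State n)} (hA : Convex ℝ A) :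
    Convex ℝ (pontryaginDiff A B) := by
  intro x hx y hy a b ha hb hab v hv
  have h := hA (hx v hv) (hy v hv) ha hb hab
  have e : a • (x + v) + b • (y + v) = a • x + b • y + v := by
    rw [smul_add, smul_add, add_add_add_comm, ← add_smul, hab, one_smul]
  rwa [e] at h

theorem IsFeasible.bezierState_mem {S : Plant n q} {D : Design n} (hn : 0 < n) (hD : D.Valid S)
    {a : Anchors n N} {x : State n} {p : Plan n N} (hp : IsFeasible S D a x p) (k : Fin N)
    {τ : ℝ} (hτ : τ ∈ Icc 0 D.T) : bezierState D.T (p.ξ k) τ ∈ pontryaginDiff S.X D.E :=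
  CMPC.bezierState_mem hn hD.T_pos (convex_pontryaginDiff S.convex_X) (hp.hull k) hτ

theorem IsFeasible.x_succ_mem {S : Plant n q} {D : Design n} (hn : 0 < n) (hD : D.Valid S)
    {a : Anchors n N} {x : State n} {p : Plan n N} (hp : IsFeasible S D a x p) (k : Fin N) :
    p.x k.succ ∈ S.X := by
  have h := hp.bezierState_mem hn hD k (right_mem_Icc.2 hD.T_pos.le)
  rw [hp.bezier, bezierState_ctrl_end hn hD.T_pos] at h
  simpa using h 0 (hD.zero_mem_E hn)

/-- With the unprojected matrix in place of `M` this is an equality, namely the expansion of the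
product. Projecting only increases the right-hand side. -/
theorem mul_abs_le_conic {S : Plant n q} (D : Design n) (x : State n) (s : Fin 2 → ℝ) :
    (|(S.g x)⁻¹| + D.β * (D.ebar + s 0)) *
        (D.α * (D.ebar + s 0) + s 1 + ‖D.K‖ * D.ebar) ≤
      (1 / 2) * (s ⬝ᵥ D.M.mulVec s) + Nvec S D x ⬝ᵥ s + Gam S D x := by
  have h1 := dotProduct_mulVec_le_psdProj _ (tildeM_isHermitian D.α D.β) s
  have h2 : s ⬝ᵥ (!![2 * D.α * D.β, D.β; D.β, 0] : Matrix (Fin 2) (Fin 2) ℝ).mulVec s =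
      2 * D.α * D.β * s 0 ^ 2 + 2 * D.β * (s 0 * s 1) := by
    simp [Matrix.mulVec, dotProduct, Fin.sum_univ_two]
    ring
  rw [h2] at h1
  have h3 : Nvec S D x ⬝ᵥ s = (2 * D.α * D.β * D.ebar + D.α * |(S.g x)⁻¹| +
      D.β * ‖D.K‖ * D.ebar) * s 0 + (|(S.g x)⁻¹| + D.β * D.ebar) * s 1 := by
    simp [Nvec, dotProduct, Fin.sum_univ_two]
  rw [h3, Gam]
  change _ ≤ s ⬝ᵥ D.M.mulVec s at h1
  linarith

/-- Near a planned reference the state constraint and the input constraint are satisfied. -/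
theorem IsFeasible.constraints {S : Plant n q} {D : Design n} (hn : 0 < n) (hS : S.Valid)
    (hD : D.Valid S) (hα0 : 0 ≤ D.α) (hβ0 : 0 ≤ D.β)
    (hα : ∀ x ∈ S.X, ∀ y ∈ S.X, |S.f x - S.f y| ≤ D.α * ‖x - y‖)
    (hβ : ∀ x ∈ S.X, ∀ y ∈ S.X, |(S.g x)⁻¹ - (S.g y)⁻¹| ≤ D.β * ‖x - y‖)
    {a : Anchors n N} (ha : ∀ k, (a k).1 ∈ S.X) {x₀ : State n} {p : Plan n N}
    (hp : IsFeasible S D a x₀ p) (k : Fin N) {τ : ℝ} (hτ : τ ∈ Icc 0 D.T) {x : State n}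
    (hx : x - bezierState D.T (p.ξ k) τ ∈ D.E) :
    x ∈ S.X ∧ |clfInput S D x (bezierState D.T (p.ξ k) τ) (bezierDeriv D.T (p.ξ k) n τ)|
      ≤ D.umax := by
  set y := bezierState D.T (p.ξ k) τ
  set v := bezierDeriv D.T (p.ξ k) n τ
  have hxX : x ∈ S.X := by
    have := hp.bezierState_mem hn hD k hτ _ hx
    rwa [add_sub_cancel] at this
  refine ⟨hxX, ?_⟩
  have he : ‖x - y‖ ≤ D.ebar := hD.norm_le_ebar hn hx
  -- Closed balls are convex, so the conic bounds on control points hold along the curve.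
  have hs0 : ‖y - (a k).1‖ ≤ p.s k 0 := by
    have h := CMPC.bezierState_mem hn hD.T_pos (convex_closedBall (a k).1 (p.s k 0))
      (fun i => mem_closedBall_iff_norm.2 (hp.conic_state k i)) hτ
    exact mem_closedBall_iff_norm.1 h
  have hs1 : |v - S.f (a k).1| ≤ p.s k 1 := by
    have h := bezierDeriv_mem hn hD.T_pos (convex_closedBall (S.f (a k).1) (p.s k 1)) n
      (fun i => mem_closedBall_iff_norm.2 (hp.conic_deriv k i)) hτ
    exact mem_closedBall_iff_norm.1 h
  have hxa : ‖x - (a k).1‖ ≤ D.ebar + p.s k 0 := by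
    have : x - (a k).1 = (x - y) + (y - (a k).1) := by abel
    rw [this]
    exact (norm_add_le _ _).trans (add_le_add he hs0)
  have hf : |S.f x - v| ≤ D.α * (D.ebar + p.s k 0) + p.s k 1 := by
    have h1 := (hα x hxX _ (ha k)).trans (mul_le_mul_of_nonneg_left hxa hα0)
    have h2 : S.f x - v = (S.f x - S.f (a k).1) - (v - S.f (a k).1) := by ring
    rw [h2]
    exact (abs_sub _ _).trans (add_le_add h1 hs1)
  have hg : |(S.g x)⁻¹| ≤ |(S.g (a k).1)⁻¹| + D.β * (D.ebar + p.s k 0) := by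
    have h1 := (hβ x hxX _ (ha k)).trans (mul_le_mul_of_nonneg_left hxa hβ0)
    have h2 := abs_sub_abs_le_abs_sub (S.g x)⁻¹ (S.g (a k).1)⁻¹
    linarith
  have hK : ‖D.K‖ * ‖x - y‖ ≤ ‖D.K‖ * D.ebar := mul_le_mul_of_nonneg_left he (norm_nonneg _)
  refine (abs_clfInput_le hS hD x y v).trans ?_
  refine le_trans ?_ ((mul_abs_le_conic (S := S) D (a k).1 (p.s k)).trans (hp.quadratic k))
  exact mul_le_mul hg (add_le_add hf hK) (by positivity) ((abs_nonneg _).trans hg)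

/-- Since `f(0) = 0`, the linearization at the origin has no affine term, so resting there with zero
input satisfies its dynamics. -/
theorem linC_zero {S : Plant n q} (hS : S.Valid) (T : ℝ) : linC S T (0, 0) = 0 := by
  have h : linCc S (0, 0) = 0 := by
    have : chain (0 : State n) 0 = 0 := by
      ext j
      simp [chain]
    simp [linCc, Plant.drift, hS.f_zero, this]
  simp [linC, h]

/-- Shifting a feasible plan by one step and appending the origin gives a feasible plan. -/
theorem IsFeasible.shift {S : Plant n q} {D : Design n} (hN : 0 < N) (hS : S.Valid)
    (hGam : Gam S D 0 ≤ D.umax) (h0 : (0 : State n) ∈ pontryaginDiff S.X D.E)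
    {a : Anchors n N} {x x' : State n} {p : Plan n N} (hp : IsFeasible S D a x p)
    (hx' : ∃ v ∈ D.E, p.x (Fin.succ ⟨0, hN⟩) = x' + v) :
    FTOCPFeasible S D (shiftAnchors a) x' := by
  let p' : Plan n N :=
    { x := fun k => if hk : k.val + 1 < N + 1 then p.x ⟨k.val + 1, hk⟩ else 0
      u := fun k => if hk : k.val + 1 < N then p.u ⟨k.val + 1, hk⟩ else 0
      s := fun k => if hk : k.val + 1 < N then p.s ⟨k.val + 1, hk⟩ else 0
      ξ := fun k => if hk : k.val + 1 < N then p.ξ ⟨k.val + 1, hk⟩ else 0 }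
  have hlt : ∀ (k : Fin N) (hk : k.val + 1 < N),
      p'.x k.castSucc = p.x (Fin.castSucc ⟨k.val + 1, hk⟩) ∧
      p'.x k.succ = p.x (Fin.succ ⟨k.val + 1, hk⟩) ∧ p'.u k = p.u ⟨k.val + 1, hk⟩ ∧
      p'.s k = p.s ⟨k.val + 1, hk⟩ ∧ p'.ξ k = p.ξ ⟨k.val + 1, hk⟩ ∧
      shiftAnchors a k = a ⟨k.val + 1, hk⟩ := by
    intro k hk
    have hk1 : k.val + 1 < N + 1 := by omega
    have hk2 : k.val + 1 + 1 < N + 1 := by omega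
    refine ⟨?_, ?_, ?_, ?_, ?_, ?_⟩
    · simp [p', hk1]
    · simp [p', hk]
    · simp [p', hk]
    · simp [p', hk]
    · simp [p', hk]
    · simp [shiftAnchors, hk]
  -- The appended step is `k = N - 1`. It starts at the old terminal state, which is `0`, so its
  -- curve vanishes, `s = 0` suffices, and the quadratic constraint reduces to `Γ(0) ≤ u_max`.
  have hge : ∀ (k : Fin N), ¬ k.val + 1 < N →
      p'.x k.castSucc = 0 ∧ p'.x k.succ = 0 ∧ p'.u k = 0 ∧
      p'.s k = 0 ∧ p'.ξ k = 0 ∧ shiftAnchors a k = (0, 0) := by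
    intro k hk
    have hk1 : k.val + 1 = N := by omega
    have hk2 : (⟨k.val + 1, by omega⟩ : Fin (N + 1)) = Fin.last N := Fin.ext hk1
    refine ⟨?_, ?_, ?_, ?_, ?_, ?_⟩
    · simp only [p', Fin.val_castSucc]
      rw [dif_pos (by omega), hk2, hp.terminal]
    · simp [p', hk]
    · simp [p', hk]
    · simp [p', hk]
    · simp [p', hk]
    · simp [shiftAnchors, hk]
  refine ⟨p', ⟨fun k => ?_, ?_, ?_, fun k => ?_, fun k i => ?_, fun k i => ?_, fun k i => ?_,
    fun k => ?_⟩⟩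
  · by_cases hk : k.val + 1 < N
    · obtain ⟨e1, e2, e3, -, -, e6⟩ := hlt k hk
      rw [e1, e2, e3, e6]
      exact hp.dynamics _
    · obtain ⟨e1, e2, e3, -, -, e6⟩ := hge k hk
      rw [e1, e2, e3, e6, linC_zero hS]
      simp
  · obtain ⟨v, hv, hxv⟩ := hx'
    refine ⟨v, hv, ?_⟩
    rw [← hxv]
    simp [p', hN]
  · simp [p']
  · by_cases hk : k.val + 1 < N
    · obtain ⟨e1, e2, -, -, e5, -⟩ := hlt k hk
      rw [e1, e2, e5]
      exact hp.bezier _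
    · obtain ⟨e1, e2, -, -, e5, -⟩ := hge k hk
      rw [e1, e2, e5, ctrl_zero]
  · by_cases hk : k.val + 1 < N
    · obtain ⟨-, -, -, -, e5, -⟩ := hlt k hk
      rw [e5]
      exact hp.hull _ i
    · obtain ⟨-, -, -, -, e5, -⟩ := hge k hk
      rw [e5, zeta_zero]
      exact h0
  · by_cases hk : k.val + 1 < N
    · obtain ⟨-, -, -, e4, e5, e6⟩ := hlt k hk
      rw [e4, e5, e6]
      exact hp.conic_state _ i
    · obtain ⟨-, -, -, e4, e5, e6⟩ := hge k hk
      rw [e4, e5, e6, zeta_zero]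
      simp
  · by_cases hk : k.val + 1 < N
    · obtain ⟨-, -, -, e4, e5, e6⟩ := hlt k hk
      rw [e4, e5, e6]
      exact hp.conic_deriv _ i
    · obtain ⟨-, -, -, e4, e5, e6⟩ := hge k hk
      rw [e4, e5, e6, derivCtrl_zero]
      simp [hS.f_zero]
  · by_cases hk : k.val + 1 < N
    · obtain ⟨-, -, -, e4, -, e6⟩ := hlt k hk
      rw [e4, e6]
      exact hp.quadratic _
    · obtain ⟨-, -, -, e4, -, e6⟩ := hge k hk
      rw [e4, e6]
      simpa using hGam

/-! ### Constraint satisfaction along closed-loop solutions -/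

theorem floor_div_eq {T t : ℝ} (hT : 0 < T) {i : ℕ} (h1 : i * T ≤ t) (h2 : t < i * T + T) :
    ⌊t / T⌋₊ = i := by
  have h0 : 0 ≤ t := (by positivity : 0 ≤ i * T).trans h1
  rw [Nat.floor_eq_iff (div_nonneg h0 hT.le), le_div_iff₀ hT, div_lt_iff₀ hT]
  exact ⟨h1, by linarith⟩

theorem refTraj_eq {T : ℝ} (hT : 0 < T) (hN : 0 < N) (x : Fin (N + 1) → State n) {t₀ t : ℝ}
    (h : t < t₀ + T) :
    refTraj T x t₀ t =
      bezierState T (ctrl T (x (Fin.castSucc ⟨0, hN⟩)) (x (Fin.succ ⟨0, hN⟩))) (t - t₀) := by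
  have h0 : ⌊(t - t₀) / T⌋₊ = 0 := by
    rw [Nat.floor_eq_zero, div_lt_one hT]
    linarith
  simp only [refTraj, h0, hN, dif_pos]
  simp [bezierState]

theorem refDerivLast_eq {T : ℝ} (hT : 0 < T) (hN : 0 < N) (x : Fin (N + 1) → State n) {t₀ t : ℝ}
    (h : t < t₀ + T) :
    refDerivLast T x t₀ t =
      bezierDeriv T (ctrl T (x (Fin.castSucc ⟨0, hN⟩)) (x (Fin.succ ⟨0, hN⟩))) n (t - t₀) := by
  have h0 : ⌊(t - t₀) / T⌋₊ = 0 := by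
    rw [Nat.floor_eq_zero, div_lt_one hT]
    linarith
  simp only [refDerivLast, h0, hN, dif_pos]
  simp

/-- The control points of the first segment of a plan. -/
noncomputable def firstCtrl (hN : 0 < N) (T : ℝ) (p : Plan n N) : Fin (2 * n) → ℝ :=
  ctrl T (p.x (Fin.castSucc ⟨0, hN⟩)) (p.x (Fin.succ ⟨0, hN⟩))

/-- Only the first segment of a plan is ever tracked, since the plan is replaced after one period.
-/
theorem cmpcInput_eq (S : Plant n q) {D : Design n} (hT : 0 < D.T) (hN : 0 < N)
    (σ : ℕ → Anchors n N → State n → Plan n N) (a₀ : Anchors n N) (φ : ℝ → State n) {i : ℕ} {t : ℝ}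
    (h1 : i * D.T ≤ t) (h2 : t < i * D.T + D.T) :
    cmpcInput S D σ a₀ φ t =
      clfInput S D (φ t)
        (bezierState D.T (firstCtrl hN D.T (run S D σ a₀ φ i).2) (t - i * D.T))
        (bezierDeriv D.T (firstCtrl hN D.T (run S D σ a₀ φ i).2) n (t - i * D.T)) := by
  rw [cmpcInput, trackingController, activePoints, floor_div_eq hT h1 h2,
    refTraj_eq hT hN _ h2, refDerivLast_eq hT hN _ h2]
  rfl

theorem run_snd (S : Plant n q) (D : Design n) (σ : ℕ → Anchors n N → State n → Plan n N)
    (a₀ : Anchors n N) (φ : ℝ → State n) (i : ℕ) :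
    (run S D σ a₀ φ i).2 = σ i (run S D σ a₀ φ i).1 (φ (i * D.T)) := by
  cases i with
  | zero => simp [run]
  | succ i => simp [run]

/-- The FTOCP lets the plan start anywhere in `x ⊕ ℰ`, so the error lies in `ℰ` at the update and
invariance applies. The closed right end is included: there the input already follows the next plan,
but the old error is what recursive feasibility needs. -/
theorem IsClosedLoop.sub_mem_E {S : Plant n q} {D : Design n} (hn : 0 < n) (hN : 0 < N)
    (hS : S.Valid) (hD : D.Valid S) {σ : ℕ → Anchors n N → State n → Plan n N}
    (hσ : IsSolver S D σ) {a₀ : Anchors n N} {w : ℝ → State n}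
    (hw : ∀ t, 0 ≤ t → ‖w t‖ ≤ D.wbar) {x₀ : State n} {φ : ℝ → State n} {b : ℝ}
    (hφ : IsClosedLoop S D σ a₀ w x₀ φ b) {i : ℕ}
    (hfeas : FTOCPFeasible S D (run S D σ a₀ φ i).1 (φ (i * D.T))) {b' : ℝ} (hb : b' ≤ b)
    (hb' : b' ≤ i * D.T + D.T) :
    ∀ t ∈ Icc (i * D.T) b',
      φ t - bezierState D.T (firstCtrl hN D.T (run S D σ a₀ φ i).2) (t - i * D.T) ∈ D.E := by
  have hT := hD.T_pos
  set ξ := firstCtrl hN D.T (run S D σ a₀ φ i).2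
  have hp := (hσ i _ _ hfeas).1
  rw [← run_snd S D σ a₀ φ i] at hp
  have hy : ∀ t, HasDerivAt (fun t => bezierState D.T ξ (t - i * D.T))
      (chain (bezierState D.T ξ (t - i * D.T)) (bezierDeriv D.T ξ n (t - i * D.T))) t := fun t =>
    (hasDerivAt_bezierState hn D.T ξ (t - i * D.T)).comp_sub_const t _
  have hv : Continuous fun t => bezierDeriv D.T ξ n (t - i * D.T) :=
    (continuous_bezierDeriv hn D.T ξ n).comp (continuous_id.sub continuous_const)
  refine hD.sub_mem_E hn (by positivity) hb hφ.piecewiseC1 hy hv hw ?_ ?_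
  · have h1 := ae_restrict_of_ae_restrict_of_subset
      (Ioo_subset_Ioo (by positivity : 0 ≤ i * D.T) hb) hφ.ode
    filter_upwards [h1, ae_restrict_mem measurableSet_Ioo] with t ht hmem
    rwa [cmpcInput_eq S hT hN σ a₀ φ hmem.1.le (hmem.2.trans_le hb'),
      drift_add_clfInput hS hD] at ht
  · obtain ⟨v, hv, hxv⟩ := hp.initial
    have hstart : bezierState D.T ξ 0 = (run S D σ a₀ φ i).2.x 0 :=
      bezierState_ctrl_zero hn hT _ _
    rw [sub_self, hstart, hxv, sub_add_cancel_left]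
    exact D.neg_mem_E hv

/-- The induction also carries the linearization points in `𝒳`, where the Lipschitz bounds are
available. Planned states stay there because they are end points of curves in `𝒳 ⊖ ℰ` and `0 ∈ ℰ`.
-/
theorem IsClosedLoop.run_feasible {S : Plant n q} {D : Design n} (hn : 0 < n) (hN : 0 < N)
    (hS : S.Valid) (hD : D.Valid S) (hGam : Gam S D 0 ≤ D.umax)
    (h0 : (0 : State n) ∈ pontryaginDiff S.X D.E)
    {σ : ℕ → Anchors n N → State n → Plan n N} (hσ : IsSolver S D σ) {a₀ : Anchors n N}
    (ha₀ : ∀ k, (a₀ k).1 ∈ S.X) {w : ℝ → State n} (hw : ∀ t, 0 ≤ t → ‖w t‖ ≤ D.wbar)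
    {x₀ : State n} (hfeas : FTOCPFeasible S D a₀ x₀) {φ : ℝ → State n} {b : ℝ}
    (hφ : IsClosedLoop S D σ a₀ w x₀ φ b) (i : ℕ) (hi : i * D.T ≤ b) :
    (∀ k, ((run S D σ a₀ φ i).1 k).1 ∈ S.X) ∧
      FTOCPFeasible S D (run S D σ a₀ φ i).1 (φ (i * D.T)) := by
  have hT := hD.T_pos
  induction i with
  | zero =>
    refine ⟨ha₀, ?_⟩
    rw [Nat.cast_zero, zero_mul, hφ.initial]
    exact hfeas
  | succ i ih =>
    have e : ((i + 1 : ℕ) : ℝ) * D.T = i * D.T + D.T := by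
      push_cast
      ring
    obtain ⟨ihX, ihf⟩ := ih (by rw [e] at hi; linarith)
    have hp := (hσ i _ _ ihf).1
    rw [← run_snd S D σ a₀ φ i] at hp
    have hend := hφ.sub_mem_E hn hN hS hD hσ hw ihf (b' := i * D.T + D.T) (e ▸ hi) le_rfl
      (i * D.T + D.T) ⟨by linarith, le_rfl⟩
    rw [add_sub_cancel_left, firstCtrl, bezierState_ctrl_end hn hT] at hend
    have hshift : FTOCPFeasible S D (shiftAnchors (run S D σ a₀ φ i).1)
        (φ ((i + 1 : ℕ) * D.T)) := by
      refine hp.shift hN hS hGam h0 ⟨_, D.neg_mem_E hend, ?_⟩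
      rw [e]
      abel
    by_cases hnext : FTOCPFeasible S D (nextAnchors (run S D σ a₀ φ i).2) (φ ((i + 1 : ℕ) * D.T))
    · have hrun : (run S D σ a₀ φ (i + 1)).1 = nextAnchors (run S D σ a₀ φ i).2 := if_pos hnext
      rw [hrun]
      exact ⟨fun k => hp.x_succ_mem hn hD k, hnext⟩
    · have hrun : (run S D σ a₀ φ (i + 1)).1 = shiftAnchors (run S D σ a₀ φ i).1 := if_neg hnext
      rw [hrun]
      refine ⟨fun k => ?_, hshift⟩
      unfold shiftAnchors
      split_ifs
      · exact ihX _
      · exact interior_subset hS.zero_mem_interior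

theorem IsClosedLoop.constraints {S : Plant n q} {D : Design n} (hn : 0 < n) (hN : 0 < N)
    (hS : S.Valid) (hD : D.Valid S) (hα0 : 0 ≤ D.α) (hβ0 : 0 ≤ D.β)
    (hα : ∀ x ∈ S.X, ∀ y ∈ S.X, |S.f x - S.f y| ≤ D.α * ‖x - y‖)
    (hβ : ∀ x ∈ S.X, ∀ y ∈ S.X, |(S.g x)⁻¹ - (S.g y)⁻¹| ≤ D.β * ‖x - y‖)
    (hGam : Gam S D 0 ≤ D.umax) (h0 : (0 : State n) ∈ pontryaginDiff S.X D.E)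
    {σ : ℕ → Anchors n N → State n → Plan n N} (hσ : IsSolver S D σ) {a₀ : Anchors n N}
    (ha₀ : ∀ k, (a₀ k).1 ∈ S.X) {w : ℝ → State n} (hw : ∀ t, 0 ≤ t → ‖w t‖ ≤ D.wbar)
    {x₀ : State n} (hfeas : FTOCPFeasible S D a₀ x₀) {φ : ℝ → State n} {b : ℝ}
    (hφ : IsClosedLoop S D σ a₀ w x₀ φ b) {t : ℝ} (ht : t ∈ Icc 0 b) :
    φ t ∈ S.X ∧ cmpcInput S D σ a₀ φ t ∈ Icc (-D.umax) D.umax := by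
  have hT := hD.T_pos
  set i := ⌊t / D.T⌋₊
  have h1 : i * D.T ≤ t := by
    rw [← le_div_iff₀ hT]
    exact Nat.floor_le (div_nonneg ht.1 hT.le)
  have h2 : t < i * D.T + D.T := by
    have := Nat.lt_floor_add_one (t / D.T)
    rw [div_lt_iff₀ hT] at this
    linarith
  obtain ⟨haX, hif⟩ := hφ.run_feasible hn hN hS hD hGam h0 hσ ha₀ hw hfeas i (h1.trans ht.2)
  have hp := (hσ i _ _ hif).1
  rw [← run_snd S D σ a₀ φ i] at hp
  have hE := hφ.sub_mem_E hn hN hS hD hσ hw hif ht.2 h2.le t ⟨h1, le_rfl⟩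
  have hξ : firstCtrl hN D.T (run S D σ a₀ φ i).2 = (run S D σ a₀ φ i).2.ξ ⟨0, hN⟩ :=
    (hp.bezier _).symm
  rw [hξ] at hE
  have hc := hp.constraints hn hS hD hα0 hβ0 hα hβ haX ⟨0, hN⟩
    (τ := t - i * D.T) ⟨by linarith, by linarith⟩ hE
  rw [cmpcInput_eq S hT hN σ a₀ φ h1 h2, hξ]
  exact ⟨hc.1, abs_le.1 hc.2⟩

/-! ### Existence of closed-loop solutions -/

/-- For the zero reference the error is the state, so `ψ` can be recovered from the controller: `ψ =
-f - g k`. -/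
theorem trackingController_zero {S : Plant n q} {D : Design n} (hN : 0 < N) (hS : S.Valid)
    (hD : D.Valid S) (x : State n) :
    trackingController S D (0 : Fin (N + 1) → State n) 0 x 0 = (S.g x)⁻¹ * (- S.f x - D.psi x) := by
  have hT := hD.T_pos
  rw [trackingController, refTraj_eq hT hN _ (by simpa using hT),
    refDerivLast_eq hT hN _ (by simpa using hT), clfInput_eq hS hD]
  simp only [Pi.zero_apply, ctrl_zero]
  have h1 : bezierState D.T (0 : Fin (2 * n) → ℝ) (0 - 0) = 0 := by
    ext j
    simp [bezierState, bezierDeriv, derivCtrl_zero]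
  have h2 : bezierDeriv D.T (0 : Fin (2 * n) → ℝ) n (0 - 0) = 0 := by
    simp [bezierDeriv, derivCtrl_zero]
  rw [h1, h2, sub_zero, zero_sub]

theorem exists_ball_psi_lipschitz {S : Plant n q} {D : Design n} (hN : 0 < N) (hS : S.Valid)
    (hD : D.Valid S) (hreg : ControllerRegular S D N) :
    ∃ r > 0, ∃ L : ℝ≥0, LipschitzOnWith L D.psi (Metric.ball 0 r) := by
  have hT := hD.T_pos
  obtain ⟨Ck, Uk, hUk, hk⟩ := hreg 0 0 le_rfl 0
  replace hk := hk 0 ⟨le_rfl, by positivity⟩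
  obtain ⟨Cf, Uf, hUf, hf⟩ := (hS.f_contDiff.contDiffAt (x := 0)).exists_lipschitzOnWith
  obtain ⟨Cg, Ug, hUg, hg⟩ := (hS.g_contDiff.contDiffAt (x := 0)).exists_lipschitzOnWith
  set k : State n → ℝ := fun x => trackingController S D (0 : Fin (N + 1) → State n) 0 x 0
  have hbdd : ∀ h : State n → ℝ, ContinuousAt h 0 → ∀ᶠ x in 𝓝 0, |h x| < |h 0| + 1 := fun h hh =>
    hh.abs.eventually (gt_mem_nhds (lt_add_one _))
  have hkc : ContinuousAt k 0 := hk.continuousOn.continuousAt hUk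
  have hgc : ContinuousAt S.g 0 := hS.g_contDiff.continuous.continuousAt
  obtain ⟨r, hr, hball⟩ := Metric.eventually_nhds_iff_ball.1 (((hbdd k hkc).and (hbdd S.g hgc)).and
    ((eventually_mem_set.2 hUk).and ((eventually_mem_set.2 hUf).and (eventually_mem_set.2 hUg))))
  have hpsi : ∀ x, D.psi x = - S.f x - S.g x * k x := by
    intro x
    have h1 : k x = (S.g x)⁻¹ * (- S.f x - D.psi x) := trackingController_zero hN hS hD x
    rw [h1, mul_inv_cancel_left₀ (hS.g_ne_zero x)]
    ring
  refine ⟨r, hr, Cf + ((|S.g 0| + 1).toNNReal * Ck + Cg * (|k 0| + 1).toNNReal), ?_⟩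
  refine LipschitzOnWith.of_dist_le_mul fun x hx y hy => ?_
  obtain ⟨⟨-, hgx⟩, hx1, hx2, hx3⟩ := hball x hx
  obtain ⟨⟨hky, -⟩, hy1, hy2, hy3⟩ := hball y hy
  have h1 := hk.dist_le_mul x hx1 y hy1
  have h2 := hf.dist_le_mul x hx2 y hy2
  have h3 := hg.dist_le_mul x hx3 y hy3
  rw [Real.dist_eq] at h1 h2 h3 ⊢
  change |k x - k y| ≤ _ at h1
  have e : D.psi x - D.psi y =
      (S.f y - S.f x) + (S.g x * (k y - k x) + (S.g y - S.g x) * k y) := by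
    rw [hpsi, hpsi]
    ring
  rw [abs_sub_comm] at h1 h2 h3
  have h4 : |S.g x * (k y - k x)| ≤ (|S.g 0| + 1) * (Ck * dist x y) := by
    rw [abs_mul]
    exact mul_le_mul hgx.le h1 (abs_nonneg _) (by positivity)
  have h5 : |(S.g y - S.g x) * k y| ≤ Cg * dist x y * (|k 0| + 1) := by
    rw [abs_mul]
    exact mul_le_mul h3 hky.le (abs_nonneg _) (by positivity)
  rw [e]
  refine (abs_add_le _ _).trans ((add_le_add h2 ((abs_add_le _ _).trans (add_le_add h4 h5))).trans
    (le_of_eq ?_))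
  push_cast
  rw [Real.coe_toNNReal _ (by positivity), Real.coe_toNNReal _ (by positivity)]
  ring

/-- Local Lipschitz continuity of the controllers makes the feedback correction, which is
positively homogeneous, globally Lipschitz continuous. -/
theorem exists_psi_lipschitz {S : Plant n q} {D : Design n} (hN : 0 < N) (hS : S.Valid)
    (hD : D.Valid S) (hreg : ControllerRegular S D N) : ∃ L : ℝ≥0, LipschitzWith L D.psi := by
  obtain ⟨r, hr, L, hL⟩ := exists_ball_psi_lipschitz hN hS hD hreg
  refine ⟨L, LipschitzWith.of_dist_le_mul fun x y => ?_⟩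
  -- This factor scales both points into the ball where `ψ` is Lipschitz. By homogeneity it cancels
  -- from the estimate.
  set c : ℝ := r / (‖x‖ + ‖y‖ + 1)
  have hc : 0 < c := by positivity
  have hmem : ∀ z : State n, ‖z‖ ≤ ‖x‖ + ‖y‖ → c • z ∈ Metric.ball 0 r := by
    intro z hz
    rw [mem_ball_zero_iff, norm_smul, Real.norm_of_nonneg hc.le, div_mul_eq_mul_div,
      div_lt_iff₀ (by positivity)]
    exact mul_lt_mul_of_pos_left (by linarith) hr
  have h := hL.dist_le_mul _ (hmem x (by linarith [norm_nonneg y])) _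
    (hmem y (by linarith [norm_nonneg x]))
  rw [D.psi_smul hc, D.psi_smul hc, dist_smul₀, Real.dist_eq, ← mul_sub, abs_mul, abs_of_pos hc,
    Real.norm_of_nonneg hc.le, mul_left_comm] at h
  exact le_of_mul_le_mul_left h hc

theorem exists_lipschitzWith_chain_psi {D : Design n} {L : ℝ≥0} (hψ : LipschitzWith L D.psi) :
    ∃ K : ℝ≥0, LipschitzWith K fun e : State n => chain e (- D.psi e) := by
  have h1 : LipschitzWith (max 1 L) fun e : State n => (e, - D.psi e) :=
    LipschitzWith.id.prodMk hψ.neg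
  have h2 : LipschitzWith (‖chainCLM n‖₊ * max 1 L) fun e : State n => chainCLM n (e, - D.psi e) :=
    (chainCLM n).lipschitz.comp h1
  exact ⟨_, h2⟩

/-- Writing `e = z + W` with a primitive `W` of the disturbance leaves an equation for `z` that is
continuous in time and globally Lipschitz in space. -/
theorem exists_error_solution {D : Design n} {L : ℝ≥0} (hψ : LipschitzWith L D.psi)
    {w : ℝ → State n} (hw : PiecewiseContinuous w) (hwb : ∀ t, 0 ≤ t → ‖w t‖ ≤ D.wbar)
    {T t₀ : ℝ} (hT : 0 ≤ T) (ht₀ : 0 ≤ t₀) (e₀ : State n) :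
    ∃ e : ℝ → State n, e t₀ = e₀ ∧ ContinuousOn e (Icc t₀ (t₀ + T)) ∧
      ∀ t ∈ Ioo t₀ (t₀ + T), ContinuousAt w t →
        HasDerivAt e (chain (e t) (- D.psi (e t)) + w t) t := by
  obtain ⟨W, hWc, hW⟩ := hw.exists_primitive hwb
  obtain ⟨K, hG⟩ := exists_lipschitzWith_chain_psi hψ
  have hF : ∀ t, LipschitzWith K fun z : State n => chain (z + W t) (- D.psi (z + W t)) :=
    fun t => LipschitzWith.of_dist_le_mul fun z z' =>
      (hG.dist_le_mul (z + W t) (z' + W t)).trans_eq (by rw [dist_add_right])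
  have hFc : ∀ z : State n, Continuous fun t => chain (z + W t) (- D.psi (z + W t)) := fun z =>
    hG.continuous.comp (continuous_const.add hWc)
  obtain ⟨z, hz₀, hz⟩ := exists_solution_Icc hF hFc t₀ (e₀ - W t₀) hT
  refine ⟨fun t => z t + W t, by simp [hz₀], ?_, fun t ht hct => ?_⟩
  · exact (HasDerivWithinAt.continuousOn hz).add hWc.continuousOn
  · exact ((hz t (Ioo_subset_Icc_self ht)).hasDerivAt (Icc_mem_nhds ht.1 ht.2)).add
      (hW t (ht₀.trans_lt ht.1) hct)

/-- The closed loop over one sampling period, in terms of the control points of the reference. -/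
structure IsSegment (D : Design n) (w : ℝ → State n) (t₀ : ℝ) (ξ : Fin (2 * n) → ℝ)
    (φ : ℝ → State n) : Prop where
  continuousOn : ContinuousOn φ (Icc t₀ (t₀ + D.T))
  hasDerivAt : ∀ t ∈ Ioo t₀ (t₀ + D.T), ContinuousAt w t →
    HasDerivAt φ (chain (φ t) (bezierDeriv D.T ξ n (t - t₀) -
      D.psi (φ t - bezierState D.T ξ (t - t₀))) + w t) t

theorem exists_isSegment (hn : 0 < n) {D : Design n} (hT : 0 < D.T) {L : ℝ≥0}
    (hψ : LipschitzWith L D.psi) {w : ℝ → State n} (hw : PiecewiseContinuous w)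
    (hwb : ∀ t, 0 ≤ t → ‖w t‖ ≤ D.wbar) {t₀ : ℝ} (ht₀ : 0 ≤ t₀) (x : State n)
    (ξ : Fin (2 * n) → ℝ) : ∃ φ, φ t₀ = x ∧ IsSegment D w t₀ ξ φ := by
  obtain ⟨e, he₀, hec, he⟩ := exists_error_solution hψ hw hwb hT.le ht₀
    (x - bezierState D.T ξ 0)
  have hy : ∀ t, HasDerivAt (fun t => bezierState D.T ξ (t - t₀))
      (chain (bezierState D.T ξ (t - t₀)) (bezierDeriv D.T ξ n (t - t₀))) t := fun t =>
    (hasDerivAt_bezierState hn D.T ξ (t - t₀)).comp_sub_const t _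
  have hyc : Continuous fun t => bezierState D.T ξ (t - t₀) :=
    continuous_iff_continuousAt.2 fun t => (hy t).continuousAt
  refine ⟨fun t => e t + bezierState D.T ξ (t - t₀), by simp [he₀], hec.add hyc.continuousOn,
    fun t ht hct => ((he t ht hct).add (hy t)).congr_deriv ?_⟩
  rw [add_sub_cancel_right, sub_eq_neg_add _ (D.psi (e t)), chain_add]
  abel

theorem IsSegment.congr {D : Design n} {w : ℝ → State n} {t₀ : ℝ} {ξ : Fin (2 * n) → ℝ}
    {φ φ' : ℝ → State n} (h : IsSegment D w t₀ ξ φ) (he : EqOn φ' φ (Icc t₀ (t₀ + D.T))) :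
    IsSegment D w t₀ ξ φ' := by
  refine ⟨h.continuousOn.congr he, fun t ht hct => ?_⟩
  rw [he (Ioo_subset_Icc_self ht)]
  exact (h.hasDerivAt t ht hct).congr_of_eventuallyEq
    (mem_of_superset (Icc_mem_nhds ht.1 ht.2) he)

/-- The right-hand side is continuous up to both ends of the period except for `w`, so limits of `w`
become limits of the derivative. One filter argument covers interior points and both one-sided
limits. -/
theorem IsSegment.tendsto_deriv (hn : 0 < n) {D : Design n} {L : ℝ≥0}
    (hψ : LipschitzWith L D.psi) {w : ℝ → State n} {t₀ : ℝ} {ξ : Fin (2 * n) → ℝ}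
    {φ : ℝ → State n} (h : IsSegment D w t₀ ξ φ) {t : ℝ} (ht : t ∈ Icc t₀ (t₀ + D.T))
    {l : Filter ℝ} (hl : l ≤ 𝓝[Ioo t₀ (t₀ + D.T)] t) (hcw : ∀ᶠ τ in l, ContinuousAt w τ)
    {y : State n} (hy : Tendsto w l (𝓝 y)) :
    Tendsto (deriv φ) l (𝓝 (chain (φ t) (bezierDeriv D.T ξ n (t - t₀) -
      D.psi (φ t - bezierState D.T ξ (t - t₀))) + y)) := by
  have h1 : Tendsto φ l (𝓝 (φ t)) :=
    (h.continuousOn t ht).mono_left (hl.trans (nhdsWithin_mono _ Ioo_subset_Icc_self))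
  have hlt : Tendsto (fun τ => τ - t₀) l (𝓝 (t - t₀)) :=
    ((continuous_id.sub continuous_const).tendsto t).mono_left (hl.trans nhdsWithin_le_nhds)
  have hbs : Continuous (bezierState D.T ξ) :=
    continuous_iff_continuousAt.2 fun τ => (hasDerivAt_bezierState hn D.T ξ τ).continuousAt
  have h2 := ((hbs.tendsto _).comp hlt)
  have h3 := (((continuous_bezierDeriv hn D.T ξ n).tendsto _).comp hlt)
  have h4 := (hψ.continuous.tendsto _).comp (h1.sub h2)
  have h5 := (((chainCLM n).continuous.tendsto _).comp (h1.prodMk_nhds (h3.sub h4))).add hy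
  refine h5.congr' ?_
  filter_upwards [hl self_mem_nhdsWithin, hcw] with τ hτ hcτ
  exact (h.hasDerivAt τ hτ hcτ).deriv.symm

theorem PiecewiseContinuous.eventually_continuousAt {w : ℝ → State n}
    (hw : PiecewiseContinuous w) (t : ℝ) : ∀ᶠ τ in 𝓝 t, 0 < τ → τ ≠ t → ContinuousAt w τ := by
  have hfin := (hw.1 (t + 1)).subset (sdiff_subset (t := {t}))
  have h1 : ({τ ∈ Ioc 0 (t + 1) | ¬ ContinuousAt w τ} \ {t})ᶜ ∈ 𝓝 t :=
    hfin.isClosed.isOpen_compl.mem_nhds fun h => h.2 rfl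
  filter_upwards [h1, gt_mem_nhds (lt_add_one t)] with τ hτ hlt hpos hne
  by_contra hc
  exact hτ ⟨⟨⟨hpos, hlt.le⟩, hc⟩, hne⟩

theorem exists_mem_Ico_mul {T t : ℝ} (hT : 0 < T) (ht : 0 ≤ t) :
    ∃ i : ℕ, i * T ≤ t ∧ t < i * T + T := by
  refine ⟨⌊t / T⌋₊, ?_, ?_⟩
  · rw [← le_div_iff₀ hT]
    exact Nat.floor_le (div_nonneg ht hT.le)
  · have := Nat.lt_floor_add_one (t / T)
    rw [div_lt_iff₀ hT] at this
    linarith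

theorem exists_mem_Ioc_mul {T t : ℝ} (hT : 0 < T) (ht : 0 < t) :
    ∃ i : ℕ, i * T < t ∧ t ≤ i * T + T := by
  obtain ⟨i, h1, h2⟩ := exists_mem_Ico_mul hT ht.le
  rcases eq_or_lt_of_le h1 with h | h
  · rcases i with _ | i
    · simp at h
      exact absurd h ht.ne
    · push_cast at h
      exact ⟨i, by linarith, by linarith⟩
  · exact ⟨i, h, h2.le⟩

theorem isClosedLoop_of_isSegment (hn : 0 < n) (hN : 0 < N) {S : Plant n q} {D : Design n}
    (hS : S.Valid) (hD : D.Valid S) {L : ℝ≥0} (hψ : LipschitzWith L D.psi)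
    {σ : ℕ → Anchors n N → State n → Plan n N} {a₀ : Anchors n N} {w : ℝ → State n}
    (hw : PiecewiseContinuous w) {φ : ℝ → State n}
    (hφ : ∀ i : ℕ, IsSegment D w (i * D.T) (firstCtrl hN D.T (run S D σ a₀ φ i).2) φ) (b : ℝ) :
    IsClosedLoop S D σ a₀ w (φ 0) φ b := by
  have hT := hD.T_pos
  have hcont : ∀ m : ℕ, ContinuousOn φ (Icc 0 (m * D.T)) := by
    intro m
    induction m with
    | zero => simp
    | succ m ih =>
      have e : ((m + 1 : ℕ) : ℝ) * D.T = m * D.T + D.T := by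
        push_cast
        ring
      rw [e, ← Icc_union_Icc_eq_Icc (by positivity : (0 : ℝ) ≤ m * D.T) (by linarith)]
      exact ih.union_of_isClosed (hφ m).continuousOn isClosed_Icc isClosed_Icc
  obtain ⟨m, hm⟩ := exists_nat_ge (b / D.T)
  rw [div_le_iff₀ hT] at hm
  -- Kinks can occur only at discontinuities of `w` and at update times.
  set Z : Set ℝ := {t ∈ Ioc 0 b | ¬ ContinuousAt w t} ∪ (fun i : ℕ => (i : ℝ) * D.T) '' Iic m
  have hZ : Z.Finite := (hw.1 b).union ((finite_Iic m).image _)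
  have hoff : ∀ t ∈ Ioo 0 b \ Z, ContinuousAt w t ∧ ∃ i : ℕ, t ∈ Ioo (i * D.T) (i * D.T + D.T) := by
    rintro t ⟨ht, htZ⟩
    refine ⟨by_contra fun h => htZ (Or.inl ⟨⟨ht.1, ht.2.le⟩, h⟩), ?_⟩
    obtain ⟨i, h1, h2⟩ := exists_mem_Ico_mul hT ht.1.le
    refine ⟨i, lt_of_le_of_ne h1 fun h => htZ (Or.inr ⟨i, ?_, h⟩), h2⟩
    have : (i : ℝ) * D.T < m * D.T := h1.trans_lt (ht.2.trans_le hm)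
    exact_mod_cast (lt_of_mul_lt_mul_right this hT.le).le
  refine ⟨rfl, ⟨(hcont m).mono (Icc_subset_Icc_right hm), ⟨Z, hZ, fun t ht => ?_⟩,
    fun t ht => ?_, fun t ht => ?_⟩, ?_⟩
  · obtain ⟨hct, i, hi⟩ := hoff t ht
    have hd := (hφ i).hasDerivAt t hi hct
    refine ⟨hd.differentiableAt, ?_⟩
    rw [ContinuousAt, hd.deriv]
    refine (hφ i).tendsto_deriv hn hψ (Ioo_subset_Icc_self hi)
      (by rw [isOpen_Ioo.nhdsWithin_eq hi]) ?_ hct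
    filter_upwards [hw.eventually_continuousAt t, lt_mem_nhds ht.1.1] with τ h1 h2
    by_cases h : τ = t
    · rwa [h]
    · exact h1 h2 h
  · obtain ⟨i, h1, h2⟩ := exists_mem_Ico_mul hT ht.1
    obtain ⟨y, hy⟩ := hw.2.1 t ht.1
    refine ⟨_, (hφ i).tendsto_deriv hn hψ ⟨h1, h2.le⟩ ?_ ?_ hy⟩
    · rw [← nhdsWithin_Ioo_eq_nhdsGT h2]
      exact nhdsWithin_mono _ (Ioo_subset_Ioo_left h1)
    · filter_upwards [(hw.eventually_continuousAt t).filter_mono nhdsWithin_le_nhds,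
        self_mem_nhdsWithin] with τ h3 h4
      exact h3 (ht.1.trans_lt h4) (ne_of_gt h4)
  · obtain ⟨i, h1, h2⟩ := exists_mem_Ioc_mul hT ht.1
    obtain ⟨y, hy⟩ := hw.2.2 t ht.1
    refine ⟨_, (hφ i).tendsto_deriv hn hψ ⟨h1.le, h2⟩ ?_ ?_ hy⟩
    · rw [← nhdsWithin_Ioo_eq_nhdsLT h1]
      exact nhdsWithin_mono _ (Ioo_subset_Ioo_right h2)
    · filter_upwards [(hw.eventually_continuousAt t).filter_mono nhdsWithin_le_nhds,
        self_mem_nhdsWithin, (lt_mem_nhds ht.1).filter_mono nhdsWithin_le_nhds] with τ h3 h4 h5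
      exact h3 h5 (ne_of_lt h4)
  · have hZ0 : ∀ᵐ t ∂(volume.restrict (Ioo 0 b)), t ∉ Z :=
      ae_restrict_of_ae (compl_mem_ae_iff.2 (hZ.measure_zero volume))
    filter_upwards [hZ0, ae_restrict_mem measurableSet_Ioo] with t htZ ht
    obtain ⟨hct, i, hi⟩ := hoff t ⟨ht, htZ⟩
    rw [cmpcInput_eq S hT hN σ a₀ φ hi.1.le hi.2, drift_add_clfInput hS hD]
    exact (hφ i).hasDerivAt t hi hct

open Classical in
/-- The updates of the algorithm together with the states at the update times, when `seg i x ξ`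
is the motion over the `i`-th sampling period. -/
noncomputable def sampledRun (S : Plant n q) (D : Design n) (hN : 0 < N)
    (σ : ℕ → Anchors n N → State n → Plan n N) (a₀ : Anchors n N) (x₀ : State n)
    (seg : ℕ → State n → (Fin (2 * n) → ℝ) → ℝ → State n) :
    ℕ → (Anchors n N × Plan n N) × State n
  | 0 => ((a₀, σ 0 a₀ x₀), x₀)
  | i + 1 =>
    let prev := sampledRun S D hN σ a₀ x₀ seg i
    let x := seg i prev.2 (firstCtrl hN D.T prev.1.2) ((i + 1 : ℕ) * D.T)
    let a := if FTOCPFeasible S D (nextAnchors prev.1.2) x then nextAnchors prev.1.2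
      else shiftAnchors prev.1.1
    ((a, σ (i + 1) a x), x)

theorem exists_isClosedLoop (hn : 0 < n) (hN : 0 < N) {S : Plant n q} {D : Design n}
    (hS : S.Valid) (hD : D.Valid S) (hreg : ControllerRegular S D N)
    (σ : ℕ → Anchors n N → State n → Plan n N) (a₀ : Anchors n N) {w : ℝ → State n}
    (hw : PiecewiseContinuous w) (hwb : ∀ t, 0 ≤ t → ‖w t‖ ≤ D.wbar) (x₀ : State n) :
    ∃ φ : ℝ → State n, ∀ b, IsClosedLoop S D σ a₀ w x₀ φ b := by
  have hT := hD.T_pos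
  obtain ⟨L, hψ⟩ := exists_psi_lipschitz hN hS hD hreg
  choose seg hseg₀ hseg using fun (i : ℕ) (x : State n) (ξ : Fin (2 * n) → ℝ) =>
    exists_isSegment hn hT hψ hw hwb (by positivity : 0 ≤ (i : ℝ) * D.T) x ξ
  set r := sampledRun S D hN σ a₀ x₀ seg
  set piece : ℕ → ℝ → State n := fun i => seg i (r i).2 (firstCtrl hN D.T (r i).1.2)
  let φ : ℝ → State n := fun t => piece ⌊t / D.T⌋₊ t
  have hIco : ∀ (i : ℕ) (t : ℝ), i * D.T ≤ t → t < i * D.T + D.T → φ t = piece i t := by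
    intro i t h1 h2
    change piece ⌊t / D.T⌋₊ t = _
    rw [floor_div_eq hT h1 h2]
  have hstate : ∀ i : ℕ, φ (i * D.T) = (r i).2 := by
    intro i
    rw [hIco i _ le_rfl (by linarith)]
    exact hseg₀ i _ _
  -- This resolves the circularity: `run` reads `φ` only at sampling instants, where it agrees with
  -- the recursively built states.
  have hrun : ∀ i : ℕ, run S D σ a₀ φ i = (r i).1 := by
    intro i
    induction i with
    | zero =>
      have h := hstate 0
      rw [Nat.cast_zero, zero_mul] at h
      rw [run, h]
      rfl
    | succ i ih =>
      rw [run, ih, hstate]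
      rfl
  have hIcc : ∀ i : ℕ, EqOn φ (piece i) (Icc (i * D.T) (i * D.T + D.T)) := by
    rintro i t ⟨h1, h2⟩
    rcases eq_or_lt_of_le h2 with h | h
    · have e : t = ((i + 1 : ℕ) : ℝ) * D.T := by
        push_cast
        linarith
      -- At the right end `φ` has passed to the next piece, whose initial state is by construction
      -- the end value of this one.
      rw [e, hstate]
      rfl
    · exact hIco i t h1 h
  have hsegφ : ∀ i : ℕ,
      IsSegment D w (i * D.T) (firstCtrl hN D.T (run S D σ a₀ φ i).2) φ := by
    intro i
    rw [hrun]
    exact (hseg i _ _).congr (hIcc i)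
  have h0 : φ 0 = x₀ := by
    have h := hstate 0
    rw [Nat.cast_zero, zero_mul] at h
    exact h
  refine ⟨φ, fun b => ?_⟩
  rw [← h0]
  exact isClosedLoop_of_isSegment hn hN hS hD hψ hw hsegφ b

/-! ### Least Lipschitz constants -/

/-- A bounded gradient on a compact convex set provides one Lipschitz constant. The set of all of
them is closed, so its infimum is attained. -/
theorem exists_isLeast_lipschitzOnWith {X : Set (State n)} (hX : IsCompact X) (hc : Convex ℝ X)
    {f : State n → ℝ} (hf : ContDiff ℝ 1 f) :
    ∃ C : ℝ≥0, IsLeast {C : ℝ≥0 | LipschitzOnWith C f X} C := by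
  obtain ⟨B, hB⟩ := hX.exists_bound_of_continuousOn (hf.continuous_fderiv one_ne_zero).continuousOn
  have hne : {C : ℝ≥0 | LipschitzOnWith C f X}.Nonempty := by
    refine ⟨B.toNNReal, hc.lipschitzOnWith_of_nnnorm_fderiv_le
      (fun x _ => hf.differentiable one_ne_zero x) fun x hx => ?_⟩
    rw [← NNReal.coe_le_coe, coe_nnnorm]
    exact (hB x hx).trans (Real.le_coe_toNNReal B)
  have hcl : IsClosed {C : ℝ≥0 | LipschitzOnWith C f X} := by
    simp only [lipschitzOnWith_iff_dist_le_mul, ofPred_forall]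
    refine isClosed_iInter fun x => isClosed_iInter fun _ => isClosed_iInter fun y =>
      isClosed_iInter fun _ => isClosed_le continuous_const (by fun_prop)
  exact ⟨_, hcl.isLeast_csInf hne (OrderBot.bddBelow _)⟩

theorem abs_sub_le_of_lipschitzOnWith {X : Set (State n)} {f : State n → ℝ} {C : ℝ≥0} {α : ℝ}
    (hf : LipschitzOnWith C f X) (hα : C ≤ α) :
    ∀ x ∈ X, ∀ y ∈ X, |f x - f y| ≤ α * ‖x - y‖ := by
  intro x hx y hy
  have h := hf.dist_le_mul x hx y hy
  rw [Real.dist_eq, dist_eq_norm] at h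
  exact h.trans (mul_le_mul_of_nonneg_right hα (norm_nonneg _))

end

end CMPC

/-! ### Assembly of the theorem -/

theorem mainTheorem1 {n q N : ℕ} (hn : 0 < n) (hN : 0 < N) (S : Plant n q) (hS : S.Valid) :
    ∃ αlow βlow : ℝ≥0,
      IsLeast {C : ℝ≥0 | LipschitzOnWith C S.f S.X} αlow ∧
      IsLeast {C : ℝ≥0 | LipschitzOnWith C (fun x => (S.g x)⁻¹) S.X} βlow ∧
      ∀ D : Design n, D.Valid S → (αlow : ℝ) ≤ D.α → (βlow : ℝ) ≤ D.β →
        Gam S D 0 ≤ D.umax → (0 : State n) ∈ pontryaginDiff S.X D.E →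
        ∀ a₀ : Anchors n N, (∀ k, (a₀ k).1 ∈ S.X) →
        ∀ x₀ ∈ S.X, FTOCPFeasible S D a₀ x₀ →
        ∀ σ : ℕ → Anchors n N → State n → Plan n N, IsSolver S D σ →
        ∀ w : ℝ → State n, PiecewiseContinuous w → (∀ t, 0 ≤ t → ‖w t‖ ≤ D.wbar) →
          (∀ (b : ℝ) (φ : ℝ → State n), 0 ≤ b → IsClosedLoop S D σ a₀ w x₀ φ b →
            (∀ i : ℕ, i * D.T ≤ b → FTOCPFeasible S D (run S D σ a₀ φ i).1 (φ (i * D.T))) ∧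
            ∀ t ∈ Icc 0 b, CLFWellPosed S D σ a₀ φ t ∧ φ t ∈ S.X ∧
              cmpcInput S D σ a₀ φ t ∈ Icc (-D.umax) D.umax) ∧
          (ControllerRegular S D N →
            ∃ φ : ℝ → State n, ∀ b, 0 ≤ b → IsClosedLoop S D σ a₀ w x₀ φ b) := by
  obtain ⟨αlow, hαlow⟩ := exists_isLeast_lipschitzOnWith hS.compact S.convex_X hS.f_contDiff
  obtain ⟨βlow, hβlow⟩ := exists_isLeast_lipschitzOnWith hS.compact S.convex_X
    (hS.g_contDiff.inv hS.g_ne_zero)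
  refine ⟨αlow, βlow, hαlow, hβlow, ?_⟩
  intro D hD hα hβ hGam h0 a₀ ha₀ x₀ _ hfeas σ hσ w hw hwb
  refine ⟨fun b φ _ hφ => ⟨fun i hi => ?_, fun t ht => ⟨?_, ?_⟩⟩, fun hreg => ?_⟩
  · exact (hφ.run_feasible hn hN hS hD hGam h0 hσ ha₀ hwb hfeas i hi).2
  · exact existsUnique_isCLFInput hS hD _ _ _
  · exact hφ.constraints hn hN hS hD (αlow.coe_nonneg.trans hα) (βlow.coe_nonneg.trans hβ)
      (abs_sub_le_of_lipschitzOnWith hαlow.1 hα) (abs_sub_le_of_lipschitzOnWith hβlow.1 hβ)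
      hGam h0 hσ ha₀ hwb hfeas ht
  · obtain ⟨φ, hφ⟩ := exists_isClosedLoop hn hN hS hD hreg σ a₀ hw hwb x₀
    exact ⟨φ, fun b _ => hφ b⟩
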